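/- Let $(X,\Sigma,m)$ be a $\sigma$-finite measure space and let $\mathcal A\subseteq\Sigma$ be a sub-$\sigma$-algebra such that $m|_{\mathcal A}$ is $\sigma$-finite. Let $E=E^{\mathcal A}$ be the conditional expectation, defined for nonnegative measurable functions (with values in $[0,\infty]$) and for the complex measurable functions $f$ with $E(|f|)<\infty$ a.e. Let $u,w$ be complex measurable functions with $E(|u|)<\infty$ and $E(|w|)<\infty$ a.e., and assume that $T=M_wEM_u$, $Tf=wE(uf)$, is a bounded operator on $L^2(\Sigma)$ (the product $wE(uf)$ is taken to be $0$ where $w=0$, so $E(|uf|)<\infty$ is required only where $w\neq 0$). Put $G=\{x: E(|w|^2)(x)\ne0\}$ and assume $$|E(uw)|^2\ \ge\ E(|u|^2)\,E(|w|^2)\quad\text{a.e. on } G .$$ (a) Every nonzero isolated point of the essential range of $E(uw)$ is a simple pole of the resolvent $z\mapsto (zI-T)^{-1}$, i.e. it is an isolated point of the spectrum $\sigma(T)$ at which the resolvent has a pole of order one. (b) The operator $M_{\bar u}EM_{\bar w}$, $f\mapsto \bar uE(\bar wf)$ (with the same convention where $u=0$), is bounded on $L^2(\Sigma)$. Let $\mu$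 be a nonzero isolated point of the essential range of $E(uw)$, and let $$E_\mu=\frac1{2\pi i}\int_{\partial D}(zI-T)^{-1}\,dz$$ be the Riesz idempotent of $T$ with respect to $\mu$, where $D$ is any closed disk of positive radius centered at $\mu$ that contains no other point of $\sigma(T)$. Then $E_\mu$ is self-adjoint if and only if $$N(M_wEM_u-\mu)\subseteq N(M_{\bar u}EM_{\bar w}-\bar\mu),$$ where $N$ denotes the kernel in $L^2(\Sigma)$. -/

import Mathlib

open MeasureTheory Filter Topology
open scoped ENNReal

noncomputable section

namespace WCT

section CondExp

variable {X : Type*} (m : MeasurableSpace X) {m0 : MeasurableSpace X} (μ : Measure X)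

/-- `f` is conditionable with respect to `E = E^m`: `E(|f|)` is finite almost everywhere. -/
def Conditionable (f : X → ℂ) : Prop :=
  ∀ᵐ x ∂μ, condLExp m μ (fun y => ‖f y‖ₑ) x < ∞

/-- The conditional expectation `E(f)` of a complex function, obtained from the conditional
expectations of the positive and negative parts of `Re f` and `Im f`. It is the conditional
expectation at almost every point where `E(|f|)` is finite. -/
def cexp (f : X → ℂ) (x : X) : ℂ :=
  (((condLExp m μ (fun y => ENNReal.ofReal (f y).re) x).toReal
      - (condLExp m μ (fun y => ENNReal.ofReal (-(f y).re)) x).toReal : ℝ) : ℂ)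
    + (((condLExp m μ (fun y => ENNReal.ofReal (f y).im) x).toReal
      - (condLExp m μ (fun y => ENNReal.ofReal (-(f y).im)) x).toReal : ℝ) : ℂ) * Complex.I

/-- `E(|f|²)`, the conditional expectation of a nonnegative function, with values in `[0, ∞]`. -/
def cexpSq (f : X → ℂ) : X → ℝ≥0∞ :=
  condLExp m μ (fun y => ‖f y‖ₑ ^ 2)

/-- The bounded operator `T` on `L²(Σ)` is the weighted conditional type operator
`M_w E M_u : f ↦ w E(u f)`. The product `w E(u f)` is `0` where `w` is `0`, so `E(u f)` has to
exist only where `w` does not vanish. -/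
def IsWeightedCondOp (w u : X → ℂ) (T : Lp ℂ 2 μ →L[ℂ] Lp ℂ 2 μ) : Prop :=
  ∀ f : Lp ℂ 2 μ,
    (∀ᵐ x ∂μ, w x ≠ 0 → condLExp m μ (fun y => ‖u y * f y‖ₑ) x < ∞) ∧
    ∀ᵐ x ∂μ, T f x = w x * cexp m μ (fun y => u y * f y) x

end CondExp

/-- The essential range of `f`. -/
def essRange {X : Type*} {m0 : MeasurableSpace X} (μ : Measure X) (f : X → ℂ) : Set ℂ :=
  {z | ∀ ε : ℝ, 0 < ε → 0 < μ {x | ‖f x - z‖ < ε}}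

/-- `z` is an isolated point of `S`: it belongs to `S` and is not an accumulation point of `S`. -/
def IsIsolatedPt (S : Set ℂ) (z : ℂ) : Prop :=
  z ∈ S ∧ ¬ AccPt z (𝓟 S)

section Operators

variable {H : Type*} [NormedAddCommGroup H] [NormedSpace ℂ H]

/-- `z₀` is a simple pole of the resolvent `z ↦ (z I - T)⁻¹`: an isolated point of the spectrum at
which this operator-valued function is meromorphic, with a pole of order one. -/
def IsSimplePoleOfResolvent (T : H →L[ℂ] H) (z₀ : ℂ) : Prop :=
  IsIsolatedPt (spectrum ℂ T) z₀ ∧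
    MeromorphicAt (resolvent T) z₀ ∧ meromorphicOrderAt (resolvent T) z₀ = -1

/-- `(1 / 2πi) ∫_{|z - z₀| = r} (z I - T)⁻¹ dz`: the Riesz idempotent of `T` with respect to the
isolated point `z₀` of the spectrum when the closed disk of radius `r > 0` about `z₀` contains no
other point of the spectrum. -/
def rieszIdempotent (T : H →L[ℂ] H) (z₀ : ℂ) (r : ℝ) : H →L[ℂ] H :=
  (2 * (Real.pi : ℂ) * Complex.I)⁻¹ • ∮ z in C(z₀, r), resolvent T z

end Operators

end WCT

end

namespace WCT

/-! ### Conditional expectations of functions with values in `[0, ∞]`. -/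

section CondLExp

variable {X : Type*} {m m0 : MeasurableSpace X} {μ : Measure X}

/-! Write `φ = E(uw)`. The hypothesis reverses the conditional Cauchy-Schwarz inequality, so
equality holds and `u` is a multiple of `w̄` by a function measurable for the sub-σ-algebra: with `κ
= E(|w|²)^(-1/2)`, one has `u = φ κ² w̄` wherever `0 < E(|w|²) < ∞`. Elsewhere `w = 0` or `u = 0`.
Hence, with `h = κ w`, `T f = φ h E(h̄ f)` and `E(|h|²) = 1` where `φ ≠ 0`
(`eq_mul_conj_of_cexpSq_mul_le`, `isNormalForm_of_isWeightedCondOp`).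

In this form `T` commutes with multiplication by bounded functions `b` of the sub-σ-algebra, and `T²
= φ T`. For `z ≠ 0` with `(z - φ)⁻¹` essentially bounded this gives `(z - T)⁻¹ = z⁻¹ (1 + T (z -
φ)⁻¹)` (`IsNormalForm.resolvent_eq`). Near a nonzero isolated point `z₀` of the essential range, `φ`
is either equal to `z₀` or at least `δ` away from it, so `(z - z₀)(z - T)⁻¹` converges in norm to `P
f = 1_{φ = z₀} h E(h̄ f)`. This limit is nonzero, so the pole is simple, and by Cauchy's formula `P`
is the Riesz idempotent.

The equivalence in (b) joins two statements that are always true: `P` is symmetric by its formula,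
and an eigenvector of `T` for `z₀ ≠ 0` lives where `φ = z₀`, where the conjugate operator `f ↦ φ̄ h
E(h̄ f)` acts as `z̄₀`. -/

theorem condLExp_mul_left (hm : m ≤ m0) [SigmaFinite (μ.trim hm)] {a g : X → ℝ≥0∞}
    (ha : Measurable[m] a) (hg : AEMeasurable g μ) :
    condLExp m μ (fun x => a x * g x) =ᵐ[μ] fun x => a x * condLExp m μ g x := by
  refine (ae_eq_condLExp hm μ _ (ha.mul (measurable_condLExp m μ g)) fun s hs => ?_).symm
  -- The densities `g` and `E(g)` define the same measure on the sub-σ-algebra, so they give the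
  -- same integral to `a`.
  have htrim : (μ.withDensity (condLExp m μ g)).trim hm = (μ.withDensity g).trim hm := by
    refine @Measure.ext _ m _ _ fun t ht => ?_
    rw [trim_measurableSet_eq hm ht, trim_measurableSet_eq hm ht, withDensity_apply _ (hm t ht),
      withDensity_apply _ (hm t ht), setLIntegral_condLExp hm μ g ht]
  have hsa : Measurable[m] (s.indicator a) := ha.indicator hs
  have key : ∀ k : X → ℝ≥0∞, AEMeasurable k μ →
      ∫⁻ x in s, a x * k x ∂μ = ∫⁻ x, s.indicator a x ∂(μ.withDensity k).trim hm := by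
    intro k hk
    rw [lintegral_trim hm hsa,
      lintegral_withDensity_eq_lintegral_mul₀ hk (hsa.mono hm le_rfl).aemeasurable,
      ← lintegral_indicator (hm s hs)]
    refine lintegral_congr fun x => ?_
    by_cases hx : x ∈ s <;> simp [hx, mul_comm]
  exact (key _ (measurable_condLExp' m μ g).aemeasurable).trans (htrim ▸ (key g hg).symm)

theorem condLExp_indicator (hm : m ≤ m0) [SigmaFinite (μ.trim hm)] {s : Set X}
    (hs : MeasurableSet[m] s) (g : X → ℝ≥0∞) :
    condLExp m μ (s.indicator g) =ᵐ[μ] s.indicator (condLExp m μ g) := by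
  refine (ae_eq_condLExp hm μ _ ((measurable_condLExp m μ g).indicator hs) fun t ht => ?_).symm
  rw [setLIntegral_indicator (hm s hs), setLIntegral_indicator (hm s hs),
    setLIntegral_condLExp hm μ g (hs.inter ht)]

/-- A nonnegative function vanishes almost everywhere on the zero set of its conditional
expectation. -/
theorem ae_eq_zero_of_condLExp_eq_zero (hm : m ≤ m0) [SigmaFinite (μ.trim hm)] {g : X → ℝ≥0∞}
    (hg : AEMeasurable g μ) : ∀ᵐ x ∂μ, condLExp m μ g x = 0 → g x = 0 := by
  have hs : MeasurableSet[m] {x | condLExp m μ g x = 0} :=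
    measurable_condLExp m μ g (measurableSet_singleton 0)
  -- The integral of `g` over the zero set of `E(g)` equals that of `E(g)`, hence is `0`.
  have h := setLIntegral_condLExp hm μ g hs
  rw [setLIntegral_congr_fun (hm _ hs) (g := fun _ => 0) (fun x hx => hx), lintegral_zero,
    eq_comm, lintegral_eq_zero_iff' hg.restrict] at h
  exact (ae_restrict_iff' (hm _ hs)).1 h

/-- The set where a conditional expectation is finite is covered by countably many sets of the
sub-σ-algebra which have finite measure and over which the function has a finite integral. -/
theorem exists_cover_condLExp_lt_top (hm : m ≤ m0) [SigmaFinite (μ.trim hm)] (g : X → ℝ≥0∞) :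
    ∃ B : ℕ × ℕ → Set X, (∀ n, MeasurableSet[m] (B n)) ∧ (∀ n, μ (B n) < ∞) ∧
      (∀ n, ∫⁻ x in B n, g x ∂μ < ∞) ∧ ∀ x, condLExp m μ g x < ∞ → ∃ n, x ∈ B n := by
  have hfin (n : ℕ) : μ (spanningSets (μ.trim hm) n) < ∞ := by
    rw [← trim_measurableSet_eq hm (measurableSet_spanningSets _ n)]
    exact measure_spanningSets_lt_top _ n
  have hB (n : ℕ × ℕ) : MeasurableSet[m]
      ({x | condLExp m μ g x ≤ n.1} ∩ spanningSets (μ.trim hm) n.2) :=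
    (measurable_condLExp m μ g measurableSet_Iic).inter (measurableSet_spanningSets _ _)
  refine ⟨fun n => {x | condLExp m μ g x ≤ n.1} ∩ spanningSets (μ.trim hm) n.2, hB,
    fun n => (measure_mono Set.inter_subset_right).trans_lt (hfin _), fun n => ?_, fun x hx => ?_⟩
  · rw [← setLIntegral_condLExp hm μ g (hB n)]
    calc _ ≤ ∫⁻ _ in {x | condLExp m μ g x ≤ n.1} ∩ spanningSets (μ.trim hm) n.2, (n.1 : ℝ≥0∞) ∂μ :=
          setLIntegral_mono' (hm _ (hB n)) fun x hx => hx.1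
      _ < ∞ := by
          rw [setLIntegral_const]
          exact ENNReal.mul_lt_top (ENNReal.natCast_lt_top _)
            ((measure_mono Set.inter_subset_right).trans_lt (hfin _))
  · obtain ⟨k, hk⟩ := ENNReal.exists_nat_gt hx.ne
    exact ⟨(k, spanningSetsIndex (μ.trim hm) x), hk.le, mem_spanningSetsIndex (μ.trim hm) x⟩

/-- Conditional expectations of products are finite where those of the squares are. -/
theorem condLExp_enorm_mul_lt_top {f g : X → ℂ} (hf : AEStronglyMeasurable f μ) :
    ∀ᵐ x ∂μ, cexpSq m μ f x < ∞ → cexpSq m μ g x < ∞ →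
      condLExp m μ (fun y => ‖f y * g y‖ₑ) x < ∞ := by
  have hle : (fun y => ‖f y * g y‖ₑ) ≤ᵐ[μ] (fun y => ‖f y‖ₑ ^ 2) + fun y => ‖g y‖ₑ ^ 2 := by
    refine Eventually.of_forall fun y => ?_
    simp only [Pi.add_apply, enorm_mul]
    rcases le_total ‖f y‖ₑ ‖g y‖ₑ with h | h
    · exact (mul_le_mul_left h _).trans (by rw [← sq]; exact le_add_self)
    · exact (mul_le_mul_right h _).trans (by rw [← sq]; exact le_self_add)
  filter_upwards [condLExp_mono (mΩ := m) hle,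
    condLExp_add_left (mΩ := m) (fun y => ‖g y‖ₑ ^ 2) (hf.enorm.pow_const 2)] with x h1 h2 h3 h4
  rw [h2] at h1
  exact h1.trans_lt (ENNReal.add_lt_top.2 ⟨h3, h4⟩)

theorem lintegral_enorm_sq_lt_top_of_memLp {f : X → ℂ} (hf : MemLp f 2 μ) :
    ∫⁻ x, ‖f x‖ₑ ^ 2 ∂μ < ∞ := by
  have := lintegral_rpow_enorm_lt_top_of_eLpNorm_lt_top two_ne_zero ENNReal.ofNat_ne_top hf.2
  simpa using this

theorem cexpSq_lt_top_of_memLp {f : X → ℂ} (hf : MemLp f 2 μ) :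
    ∀ᵐ x ∂μ, cexpSq m μ f x < ∞ :=
  condLExp_lt_top (lintegral_enorm_sq_lt_top_of_memLp hf).ne

end CondLExp

/-! ### The complex conditional expectation: locality, additivity, pull-out. -/

section Cexp

variable {X : Type*} {m m0 : MeasurableSpace X} {μ : Measure X} {f g a : X → ℂ}

theorem measurable_cexp (f : X → ℂ) : Measurable[m] (cexp m μ f) := by
  have (k : X → ℝ≥0∞) : Measurable[m] fun x => (condLExp m μ k x).toReal :=
    (measurable_condLExp m μ k).ennreal_toReal
  exact (Complex.measurable_ofReal.comp ((this _).sub (this _))).add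
    ((Complex.measurable_ofReal.comp ((this _).sub (this _))).mul_const _)

theorem cexp_congr_ae (h : f =ᵐ[μ] g) : cexp m μ f =ᵐ[μ] cexp m μ g := by
  have key (k : ℂ → ℝ≥0∞) :
      condLExp m μ (fun y => k (f y)) =ᵐ[μ] condLExp m μ (fun y => k (g y)) :=
    condLExp_congr_ae (h.mono fun x hx => by simp only [hx])
  filter_upwards [key fun z => ENNReal.ofReal z.re, key fun z => ENNReal.ofReal (-z.re),
    key fun z => ENNReal.ofReal z.im, key fun z => ENNReal.ofReal (-z.im)] with x h1 h2 h3 h4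
  simp only [cexp, h1, h2, h3, h4]

theorem cexp_conj (f : X → ℂ) (x : X) :
    cexp m μ (fun y => starRingEnd ℂ (f y)) x = starRingEnd ℂ (cexp m μ f x) := by
  simp only [cexp, Complex.conj_re, Complex.conj_im, neg_neg, map_add, map_mul, Complex.conj_ofReal,
    Complex.conj_I]
  push_cast
  ring

theorem cexp_ofReal {f : X → ℝ} (hf : ∀ x, 0 ≤ f x) (x : X) :
    cexp m μ (fun y => (f y : ℂ)) x
      = ((condLExp m μ (fun y => ENNReal.ofReal (f y)) x).toReal : ℂ) := by
  have h0 : condLExp m μ (fun _ => 0) = 0 := condLExp_zero μ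
  have : (fun y => ENNReal.ofReal (-f y)) = fun _ => 0 :=
    funext fun y => ENNReal.ofReal_of_nonpos (neg_nonpos.2 (hf y))
  simp [cexp, this, h0]

theorem cexp_norm_sq (f : X → ℂ) (x : X) :
    cexp m μ (fun y => f y * starRingEnd ℂ (f y)) x = ((cexpSq m μ f x).toReal : ℂ) := by
  have : (fun y => f y * starRingEnd ℂ (f y)) = fun y => ((‖f y‖ ^ 2 : ℝ) : ℂ) :=
    funext fun y => by rw [Complex.mul_conj']; push_cast; rfl
  rw [this, cexp_ofReal fun y => sq_nonneg _]
  have : (fun y => ENNReal.ofReal (‖f y‖ ^ 2)) = fun y => ‖f y‖ₑ ^ 2 :=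
    funext fun y => by rw [ENNReal.ofReal_pow (norm_nonneg _), ofReal_norm]
  rw [this, cexpSq]

theorem cexp_indicator (hm : m ≤ m0) [SigmaFinite (μ.trim hm)] {s : Set X}
    (hs : MeasurableSet[m] s) (f : X → ℂ) :
    cexp m μ (s.indicator f) =ᵐ[μ] s.indicator (cexp m μ f) := by
  have key (k : ℂ → ℝ≥0∞) (hk : k 0 = 0) : condLExp m μ (fun y => k (s.indicator f y)) =ᵐ[μ]
      s.indicator (condLExp m μ fun y => k (f y)) := by
    have : (fun y => k (s.indicator f y)) = s.indicator fun y => k (f y) :=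
      funext fun y => by by_cases hy : y ∈ s <;> simp [hy, hk]
    rw [this]
    exact condLExp_indicator hm hs _
  filter_upwards [key (fun z => ENNReal.ofReal z.re) (by simp),
    key (fun z => ENNReal.ofReal (-z.re)) (by simp), key (fun z => ENNReal.ofReal z.im) (by simp),
    key (fun z => ENNReal.ofReal (-z.im)) (by simp)] with x h1 h2 h3 h4
  by_cases hx : x ∈ s <;> simp [cexp, h1, h2, h3, h4, hx]

/-- Locality: the identities relating `u` and `w` are known only on sets of the sub-σ-algebra such
as `κ ≠ 0`. -/
theorem cexp_congr_on (hm : m ≤ m0) [SigmaFinite (μ.trim hm)] {s : Set X}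
    (hs : MeasurableSet[m] s) (h : ∀ᵐ x ∂μ, x ∈ s → f x = g x) :
    ∀ᵐ x ∂μ, x ∈ s → cexp m μ f x = cexp m μ g x := by
  have : s.indicator f =ᵐ[μ] s.indicator g := h.mono fun x hx => by
    by_cases hxs : x ∈ s <;> simp [hxs, hx]
  filter_upwards [cexp_indicator hm hs f, cexp_indicator hm hs g, cexp_congr_ae (m := m) this]
    with x h1 h2 h3 hx
  rw [h1, h2] at h3
  simpa [hx] using h3

theorem cexp_zero (x : X) : cexp m μ (fun _ => 0) x = 0 := by
  have := cexp_ofReal (m := m) (μ := μ) (f := fun _ => 0) (fun _ => le_rfl) x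
  have h0 : condLExp m μ (fun _ => 0) = 0 := condLExp_zero μ
  simpa [h0] using this

theorem cexp_eq_zero_on (hm : m ≤ m0) [SigmaFinite (μ.trim hm)] {s : Set X}
    (hs : MeasurableSet[m] s) (h : ∀ᵐ x ∂μ, x ∈ s → f x = 0) :
    ∀ᵐ x ∂μ, x ∈ s → cexp m μ f x = 0 := by
  filter_upwards [cexp_congr_on (g := fun _ => 0) hm hs h] with x hx hxs
  rw [hx hxs, cexp_zero]

theorem condLExp_congr_on (hm : m ≤ m0) [SigmaFinite (μ.trim hm)] {s : Set X} {f g : X → ℝ≥0∞}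
    (hs : MeasurableSet[m] s) (h : ∀ᵐ x ∂μ, x ∈ s → f x = g x) :
    ∀ᵐ x ∂μ, x ∈ s → condLExp m μ f x = condLExp m μ g x := by
  have : s.indicator f =ᵐ[μ] s.indicator g := h.mono fun x hx => by
    by_cases hxs : x ∈ s <;> simp [hxs, hx]
  filter_upwards [condLExp_indicator hm hs f, condLExp_indicator hm hs g,
    condLExp_congr_ae (mΩ := m) this] with x h1 h2 h3 hx
  rw [h1, h2] at h3
  simpa [hx] using h3

/-- Bridge to the Bochner conditional expectation. Linearity and pull-out are imported through it
after cutting down to sets where the functions are integrable. -/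
theorem cexp_ae_eq_condExp (hf : Integrable f μ) : cexp m μ f =ᵐ[μ] μ[f|m] := by
  have part {k : X → ℝ} (hk : Integrable k μ) :
      (fun x => (condLExp m μ (fun y => ENNReal.ofReal (k y)) x).toReal
        - (condLExp m μ (fun y => ENNReal.ofReal (-k y)) x).toReal) =ᵐ[μ] μ[k|m] := by
    have hpos {l : X → ℝ} (hl : Integrable l μ) :
        (fun x => (condLExp m μ (fun y => ENNReal.ofReal (l y)) x).toReal) =ᵐ[μ]
          μ[fun x => (ENNReal.ofReal (l x)).toReal|m] := by
      refine toReal_condLExp m hl.1.aemeasurable.ennreal_ofReal (ne_of_lt ?_)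
      refine lt_of_le_of_lt (lintegral_mono fun x => ?_) hl.2
      rw [← ofReal_norm]
      exact ENNReal.ofReal_le_ofReal (le_abs_self _)
    have hint {l : X → ℝ} (hl : Integrable l μ) :
        Integrable (fun x => (ENNReal.ofReal (l x)).toReal) μ := by
      simpa only [ENNReal.toReal_ofReal'] using hl.pos_part
    have hsub := condExp_sub (hint hk) (hint hk.neg) m
    have heq : ((fun x => (ENNReal.ofReal (k x)).toReal) -
        fun x => (ENNReal.ofReal ((-k) x)).toReal) = k := by
      funext x
      simp only [Pi.sub_apply, Pi.neg_apply, ENNReal.toReal_ofReal']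
      exact max_zero_sub_max_neg_zero_eq_self _
    rw [heq] at hsub
    filter_upwards [hpos hk, hpos hk.neg, hsub] with x h1 h2 h3
    rw [h3, Pi.sub_apply, ← h2, ← h1]
    rfl
  filter_upwards [part hf.re, part hf.im, Complex.reCLM.comp_condExp_comm (m := m) hf,
    Complex.imCLM.comp_condExp_comm (m := m) hf] with x h1 h2 h3 h4
  have e1 : (μ[fun y => (f y).re|m]) x = ((μ[f|m]) x).re := h3.symm
  have e2 : (μ[fun y => (f y).im|m]) x = ((μ[f|m]) x).im := h4.symm
  simp only [RCLike.re_to_complex, RCLike.im_to_complex] at h1 h2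
  rw [cexp, h1, h2, e1, e2, Complex.re_add_im]

theorem integral_cexp (hm : m ≤ m0) [SigmaFinite (μ.trim hm)] (hf : Integrable f μ) :
    ∫ x, cexp m μ f x ∂μ = ∫ x, f x ∂μ := by
  rw [integral_congr_ae (cexp_ae_eq_condExp hf), integral_condExp hm]

theorem integrable_indicator_of_setLIntegral {s : Set X} (hs : MeasurableSet s)
    (hf : AEStronglyMeasurable f μ) (h : ∫⁻ x in s, ‖f x‖ₑ ∂μ < ∞) :
    Integrable (s.indicator f) μ :=
  (integrable_indicator_iff hs).2 ⟨hf.restrict, h⟩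

/-- `f` and `g` need not be integrable; on each intersection of sets from their two covers both are,
and countably many such sets cover the points in question. -/
theorem cexp_add (hm : m ≤ m0) [SigmaFinite (μ.trim hm)] (hf : AEStronglyMeasurable f μ)
    (hg : AEStronglyMeasurable g μ) :
    ∀ᵐ x ∂μ, condLExp m μ (fun y => ‖f y‖ₑ) x < ∞ → condLExp m μ (fun y => ‖g y‖ₑ) x < ∞ →
      cexp m μ (fun y => f y + g y) x = cexp m μ f x + cexp m μ g x := by
  obtain ⟨B, hB, -, hBi, hBc⟩ := exists_cover_condLExp_lt_top (μ := μ) hm fun y => ‖f y‖ₑ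
  obtain ⟨C, hC, -, hCi, hCc⟩ := exists_cover_condLExp_lt_top (μ := μ) hm fun y => ‖g y‖ₑ
  have key : ∀ i j, ∀ᵐ x ∂μ, x ∈ B i ∩ C j →
      cexp m μ (fun y => f y + g y) x = cexp m μ f x + cexp m μ g x := by
    intro i j
    have hs := (hB i).inter (hC j)
    have hfi := integrable_indicator_of_setLIntegral (hm _ hs) hf
      ((lintegral_mono_set Set.inter_subset_left).trans_lt (hBi i))
    have hgi := integrable_indicator_of_setLIntegral (hm _ hs) hg
      ((lintegral_mono_set Set.inter_subset_right).trans_lt (hCi j))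
    have hadd : (B i ∩ C j).indicator (fun y => f y + g y)
        = (B i ∩ C j).indicator f + (B i ∩ C j).indicator g := Set.indicator_add _ _ _
    have h4 := cexp_ae_eq_condExp (m := m) (hfi.add hgi)
    rw [← hadd] at h4
    have h5 := condExp_add hfi hgi m
    rw [← hadd] at h5
    filter_upwards [cexp_indicator hm hs f, cexp_indicator hm hs g,
      cexp_indicator hm hs (fun y => f y + g y), h4, h5, cexp_ae_eq_condExp (m := m) hfi,
      cexp_ae_eq_condExp (m := m) hgi] with x h1 h2 h3 h4 h5 h6 h7 hx
    rw [Set.indicator_of_mem hx] at h1 h2 h3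
    rw [← h1, ← h2, ← h3, h4, h5, h6, h7, Pi.add_apply]
  filter_upwards [ae_all_iff.2 fun i => ae_all_iff.2 (key i)] with x hx h1 h2
  obtain ⟨i, hi⟩ := hBc x h1
  obtain ⟨j, hj⟩ := hCc x h2
  exact hx i j ⟨hi, hj⟩

/-- The same localization, with the extra cut `‖a‖ ≤ j`, which keeps the product integrable for
unbounded `a`. -/
theorem cexp_mul_left (hm : m ≤ m0) [SigmaFinite (μ.trim hm)] (ha : Measurable[m] a)
    (hf : AEStronglyMeasurable f μ) :
    ∀ᵐ x ∂μ, condLExp m μ (fun y => ‖f y‖ₑ) x < ∞ →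
      cexp m μ (fun y => a y * f y) x = a x * cexp m μ f x := by
  obtain ⟨B, hB, -, hBi, hBc⟩ := exists_cover_condLExp_lt_top (μ := μ) hm fun y => ‖f y‖ₑ
  have hC (j : ℕ) : MeasurableSet[m] {x | ‖a x‖ ≤ j} :=
    measurable_norm.comp ha measurableSet_Iic
  have key : ∀ i (j : ℕ), ∀ᵐ x ∂μ, x ∈ B i ∩ {x | ‖a x‖ ≤ j} →
      cexp m μ (fun y => a y * f y) x = a x * cexp m μ f x := by
    intro i j
    set s := B i ∩ {x | ‖a x‖ ≤ j} with hs_def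
    have hs : MeasurableSet[m] s := (hB i).inter (hC j)
    have hfi : Integrable (s.indicator f) μ := integrable_indicator_of_setLIntegral (hm _ hs) hf
      ((lintegral_mono_set Set.inter_subset_left).trans_lt (hBi i))
    have has : StronglyMeasurable[m] (s.indicator a) := (ha.indicator hs).stronglyMeasurable
    have hbd (x : X) : ‖s.indicator a x‖ ≤ j := by
      by_cases hx : x ∈ s
      · simpa [hx] using hx.2
      · simp [hx]
    have hmul : s.indicator (fun y => a y * f y)
        = fun y => ContinuousLinearMap.mul ℝ ℂ (s.indicator a y) (s.indicator f y) := by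
      funext y
      by_cases hy : y ∈ s <;> simp [hy]
    have hafi : Integrable (s.indicator fun y => a y * f y) μ := by
      rw [hmul]
      exact hfi.bdd_mul (has.mono hm).aestronglyMeasurable (Eventually.of_forall hbd)
    have h5 := condExp_bilin_of_stronglyMeasurable_left (ContinuousLinearMap.mul ℝ ℂ) has
      (hmul ▸ hafi) hfi
    rw [← hmul] at h5
    filter_upwards [cexp_indicator hm hs f, cexp_indicator hm hs (fun y => a y * f y),
      cexp_ae_eq_condExp (m := m) hafi, cexp_ae_eq_condExp (m := m) hfi, h5]
      with x h1 h2 h3 h4 h5 hx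
    rw [Set.indicator_of_mem hx] at h1 h2
    rw [← h1, ← h2, h3, h4, h5, Set.indicator_of_mem hx]
    rfl
  filter_upwards [ae_all_iff.2 fun i => ae_all_iff.2 (key i)] with x hx h1
  obtain ⟨i, hi⟩ := hBc x h1
  obtain ⟨j, hj⟩ := exists_nat_ge ‖a x‖
  exact hx i j ⟨hi, hj⟩

end Cexp

/-! ### Simple poles and Riesz idempotents from a limit of `(z - z₀)(z - T)⁻¹`. -/

section Resolvent

variable {H : Type*} [NormedAddCommGroup H] [NormedSpace ℂ H]
  {T P : H →L[ℂ] H} {z₀ : ℂ}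

/-- The function `(z - z₀) (z I - T)⁻¹`, with the value `P` at `z₀`. -/
noncomputable def regularizedResolvent (T P : H →L[ℂ] H) (z₀ : ℂ) : ℂ → H →L[ℂ] H :=
  Function.update (fun z => (z - z₀) • resolvent T z) z₀ P

theorem regularizedResolvent_of_ne {z : ℂ} (hz : z ≠ z₀) :
    regularizedResolvent T P z₀ z = (z - z₀) • resolvent T z :=
  Function.update_of_ne hz _ _

theorem resolvent_eq_regularizedResolvent {z : ℂ} (hz : z ≠ z₀) :
    resolvent T z = (z - z₀)⁻¹ • regularizedResolvent T P z₀ z := by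
  rw [regularizedResolvent_of_ne hz, inv_smul_smul₀ (sub_ne_zero.2 hz)]

theorem continuousAt_regularizedResolvent
    (hlim : Tendsto (fun z => (z - z₀) • resolvent T z) (𝓝[≠] z₀) (𝓝 P)) :
    ContinuousAt (regularizedResolvent T P z₀) z₀ :=
  continuousAt_update_same.2 hlim

variable [CompleteSpace H]

theorem differentiableAt_regularizedResolvent {z : ℂ} (hz : z ≠ z₀) (h : z ∈ resolventSet ℂ T) :
    DifferentiableAt ℂ (regularizedResolvent T P z₀) z := by
  have hd : DifferentiableAt ℂ (fun z => (z - z₀) • resolvent T z) z :=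
    (differentiableAt_id.sub_const z₀).smul
      (spectrum.hasDerivAt_resolvent_const_left h).differentiableAt
  refine hd.congr_of_eventuallyEq ?_
  filter_upwards [isOpen_ne.mem_nhds hz] with y hy using regularizedResolvent_of_ne hy

/-- By the removable singularity theorem the regularized resolvent is analytic at `z₀`; its value `P
≠ 0` there makes the order exactly `-1`. The relation `T P = z₀ P` puts `z₀` in the spectrum. -/
theorem isSimplePoleOfResolvent_of_tendsto (hP : P ≠ 0) (hTP : T * P = z₀ • P)
    (hres : ∀ᶠ z in 𝓝[≠] z₀, z ∈ resolventSet ℂ T)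
    (hlim : Tendsto (fun z => (z - z₀) • resolvent T z) (𝓝[≠] z₀) (𝓝 P)) :
    IsSimplePoleOfResolvent T z₀ := by
  have han : AnalyticAt ℂ (regularizedResolvent T P z₀) z₀ := by
    refine Complex.analyticAt_of_differentiable_on_punctured_nhds_of_continuousAt ?_
      (continuousAt_regularizedResolvent hlim)
    filter_upwards [hres, self_mem_nhdsWithin] with z hz hne
      using differentiableAt_regularizedResolvent hne hz
  have heq : ∀ᶠ z in 𝓝[≠] z₀, resolvent T z
      = (z - z₀) ^ (-1 : ℤ) • regularizedResolvent T P z₀ z := by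
    filter_upwards [self_mem_nhdsWithin] with z hz
    rw [zpow_neg_one, ← resolvent_eq_regularizedResolvent hz]
  have hmero : MeromorphicAt (resolvent T) z₀ := by
    have : MeromorphicAt (fun z => (z - z₀) ^ (-1 : ℤ) • regularizedResolvent T P z₀ z) z₀ :=
      (((MeromorphicAt.id z₀).sub (MeromorphicAt.const z₀ z₀)).zpow (-1)).smul han.meromorphicAt
    exact this.congr (heq.mono fun z hz => hz.symm)
  refine ⟨⟨fun hmem => ?_, fun hacc => ?_⟩, hmero, ?_⟩
  · rw [spectrum.mem_resolventSet_iff] at hmem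
    refine hP (hmem.mul_left_cancel ?_)
    rw [mul_zero, sub_mul, hTP, Algebra.algebraMap_eq_smul_one, smul_one_mul, sub_self]
  · rw [accPt_iff_frequently_nhdsNE] at hacc
    exact hacc (hres.mono fun z hz hz' => hz' hz)
  · refine (meromorphicOrderAt_eq_int_iff hmero).2 ⟨_, han, ?_, heq⟩
    rwa [regularizedResolvent, Function.update_self]

/-- Cauchy's integral formula at the centre for the regularized resolvent; the formula tolerates the
exceptional point `z₀`, where only continuity is needed. -/
theorem rieszIdempotent_eq_of_tendsto {r : ℝ} (hr : 0 < r)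
    (hspec : Metric.closedBall z₀ r ∩ spectrum ℂ T = {z₀})
    (hlim : Tendsto (fun z => (z - z₀) • resolvent T z) (𝓝[≠] z₀) (𝓝 P)) :
    rieszIdempotent T z₀ r = P := by
  have hres (z : ℂ) (hz : z ∈ Metric.closedBall z₀ r) (hne : z ≠ z₀) : z ∈ resolventSet ℂ T := by
    by_contra h
    exact hne (hspec.subset ⟨hz, h⟩)
  have hC := Complex.two_pi_I_inv_smul_circleIntegral_sub_inv_smul_of_differentiable_on_off_countable
    (f := regularizedResolvent T P z₀) (Set.countable_singleton z₀) (Metric.mem_ball_self hr)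
    (fun z hz => ContinuousAt.continuousWithinAt ?_)
    (fun z hz => differentiableAt_regularizedResolvent hz.2
      (hres z (Metric.ball_subset_closedBall hz.1) hz.2))
  · rw [rieszIdempotent, circleIntegral.integral_congr (g := fun z => (z - z₀)⁻¹ •
      regularizedResolvent T P z₀ z) hr.le
      (fun z hz => resolvent_eq_regularizedResolvent (ne_of_mem_of_not_mem hz ?_)), hC,
      regularizedResolvent, Function.update_self]
    simpa using hr.ne
  · rcases eq_or_ne z z₀ with rfl | hne
    · exact continuousAt_regularizedResolvent hlim
    · exact (differentiableAt_regularizedResolvent hne (hres z hz hne)).continuousAt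

end Resolvent

/-! ### Isolated points of the essential range. -/

section EssRange

variable {X : Type*} {m0 : MeasurableSpace X} {μ : Measure X} {φ : X → ℂ} {z₀ : ℂ}

/-- Each point outside the essential range has a ball with null preimage, and a locally null set of
the plane is null. -/
theorem measure_eq_zero_of_disjoint_essRange (hφ : Measurable φ) {s : Set ℂ} (hs : MeasurableSet s)
    (h : Disjoint s (essRange μ φ)) : ∀ᵐ x ∂μ, φ x ∉ s := by
  have : μ.map φ s = 0 := by
    refine measure_null_of_locally_null s fun z hz => ?_
    have hz' := Set.disjoint_left.1 h hz
    simp only [essRange, Set.mem_ofPred_eq, not_forall, not_lt, nonpos_iff_eq_zero] at hz'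
    obtain ⟨ε, hε, h0⟩ := hz'
    refine ⟨Metric.ball z ε, mem_nhdsWithin_of_mem_nhds (Metric.ball_mem_nhds z hε), ?_⟩
    rw [Measure.map_apply hφ Metric.isOpen_ball.measurableSet]
    rwa [show φ ⁻¹' Metric.ball z ε = {x | ‖φ x - z‖ < ε} by ext; simp [dist_eq_norm]]
  rw [Measure.map_apply hφ hs] at this
  exact measure_eq_zero_iff_ae_notMem.1 this

/-- Around an isolated point of its essential range, a function takes no other value. -/
theorem IsIsolatedPt.exists_ae_eq_or_le_norm_sub (hφ : Measurable φ)
    (h : IsIsolatedPt (essRange μ φ) z₀) :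
    ∃ δ > 0, ∀ᵐ x ∂μ, φ x = z₀ ∨ δ ≤ ‖φ x - z₀‖ := by
  obtain ⟨-, hacc⟩ := h
  rw [accPt_iff_frequently_nhdsNE, not_frequently, eventually_nhdsWithin_iff,
    Metric.eventually_nhds_iff_ball] at hacc
  obtain ⟨δ, hδ, hball⟩ := hacc
  refine ⟨δ, hδ, ?_⟩
  have := measure_eq_zero_of_disjoint_essRange (s := Metric.ball z₀ δ \ {z₀}) hφ
    (Metric.isOpen_ball.measurableSet.diff (measurableSet_singleton z₀))
    (Set.disjoint_left.2 fun z hz => hball z hz.1 hz.2)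
  filter_upwards [this] with x hx
  by_contra! hcon
  exact hx ⟨by simpa [dist_eq_norm] using hcon.2, hcon.1⟩

theorem IsIsolatedPt.measure_fiber_ne_zero (hφ : Measurable φ)
    (h : IsIsolatedPt (essRange μ φ) z₀) : μ {x | φ x = z₀} ≠ 0 := by
  obtain ⟨δ, hδ, hae⟩ := h.exists_ae_eq_or_le_norm_sub hφ
  intro h0
  refine (h.1 δ hδ).ne' ?_
  rw [measure_eq_zero_iff_ae_notMem] at h0 ⊢
  filter_upwards [h0, hae] with x h1 h2 h3
  exact h2.elim h1 fun h4 => h4.not_gt h3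

end EssRange

/-! ### Multiplication operators on `L²`. -/

section MulOp

variable {X : Type*} {m0 : MeasurableSpace X} {μ : Measure X} {b : X → ℂ} {C : ℝ}

theorem exists_mulOp (hb : AEStronglyMeasurable b μ) (hC : ∀ᵐ x ∂μ, ‖b x‖ ≤ C) :
    ∃ M : Lp ℂ 2 μ →L[ℂ] Lp ℂ 2 μ, ∀ f : Lp ℂ 2 μ, M f =ᵐ[μ] fun x => b x * f x := by
  have hle (f : Lp ℂ 2 μ) : ∀ᵐ x ∂μ, ‖b x * f x‖ ≤ C * ‖f x‖ := hC.mono fun x hx => by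
    rw [norm_mul]
    exact mul_le_mul_of_nonneg_right hx (norm_nonneg _)
  have hmem (f : Lp ℂ 2 μ) : MemLp (fun x => b x * f x) 2 μ :=
    (Lp.memLp f).of_le_mul (hb.mul (Lp.aestronglyMeasurable f)) (hle f)
  refine ⟨LinearMap.mkContinuous
    { toFun := fun f => (hmem f).toLp _
      map_add' := fun f g => Lp.ext ?_
      map_smul' := fun c f => Lp.ext ?_ } C fun f => ?_, fun f => (hmem f).coeFn_toLp⟩
  · filter_upwards [(hmem (f + g)).coeFn_toLp, (hmem f).coeFn_toLp, (hmem g).coeFn_toLp,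
      Lp.coeFn_add f g, Lp.coeFn_add ((hmem f).toLp _) ((hmem g).toLp _)] with x h1 h2 h3 h4 h5
    rw [h1, h5, Pi.add_apply, h2, h3, h4, Pi.add_apply, mul_add]
  · filter_upwards [(hmem (c • f)).coeFn_toLp, (hmem f).coeFn_toLp, Lp.coeFn_smul c f,
      Lp.coeFn_smul c ((hmem f).toLp _)] with x h1 h2 h3 h4
    rw [RingHom.id_apply, h1, h4, Pi.smul_apply, h2, h3, Pi.smul_apply, smul_eq_mul, smul_eq_mul,
      mul_left_comm]
  · refine Lp.norm_le_mul_norm_of_ae_le_mul ?_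
    filter_upwards [hle f, (hmem f).coeFn_toLp] with x h1 h2
    exact (congrArg norm h2).trans_le h1

open Classical in
/-- The operator of multiplication by `b` on `L²`, and `0` if there is no such operator. -/
noncomputable def mulOp (μ : Measure X) (b : X → ℂ) : Lp ℂ 2 μ →L[ℂ] Lp ℂ 2 μ :=
  if h : ∃ M : Lp ℂ 2 μ →L[ℂ] Lp ℂ 2 μ, ∀ f : Lp ℂ 2 μ, M f =ᵐ[μ] fun x => b x * f x
  then h.choose else 0

theorem mulOp_apply_ae (hb : AEStronglyMeasurable b μ) (hC : ∀ᵐ x ∂μ, ‖b x‖ ≤ C)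
    (f : Lp ℂ 2 μ) : mulOp μ b f =ᵐ[μ] fun x => b x * f x := by
  have h := exists_mulOp hb hC
  rw [mulOp, dif_pos h]
  exact h.choose_spec f

end MulOp

/-- The operator `T` on `L²` has the form `f ↦ φ h E(h̄ f)` with `φ` measurable with respect to the
sub-σ-algebra and `h` normalized by `E(|h|²) = 1` where `φ` does not vanish. -/
structure IsNormalForm {X : Type*} (m : MeasurableSpace X) {m0 : MeasurableSpace X} (μ : Measure X)
    (T : Lp ℂ 2 μ →L[ℂ] Lp ℂ 2 μ) (φ h : X → ℂ) : Prop where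
  measurable : Measurable[m] φ
  aestronglyMeasurable : AEStronglyMeasurable h μ
  cexpSq_lt_top : ∀ᵐ x ∂μ, cexpSq m μ h x < ∞
  cexpSq_eq_one : ∀ᵐ x ∂μ, φ x ≠ 0 → cexpSq m μ h x = 1
  apply_ae : ∀ f : Lp ℂ 2 μ,
    T f =ᵐ[μ] fun x => φ x * (h x * cexp m μ (fun y => starRingEnd ℂ (h y) * f y) x)

/-! ### Spectral theory of operators in normal form. -/

namespace IsNormalForm

variable {X : Type*} {m m0 : MeasurableSpace X} {μ : Measure X}
  {T : Lp ℂ 2 μ →L[ℂ] Lp ℂ 2 μ} {φ h b : X → ℂ} {z z₀ : ℂ} {C : ℝ}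

theorem aestronglyMeasurable_conj (hT : IsNormalForm m μ T φ h) :
    AEStronglyMeasurable (fun y => starRingEnd ℂ (h y)) μ :=
  Complex.continuous_conj.comp_aestronglyMeasurable hT.aestronglyMeasurable

theorem condLExp_lt_top (hT : IsNormalForm m μ T φ h) {f : X → ℂ} (hf : MemLp f 2 μ) :
    ∀ᵐ x ∂μ, condLExp m μ (fun y => ‖starRingEnd ℂ (h y) * f y‖ₑ) x < ∞ := by
  have hsq : cexpSq m μ (fun y => starRingEnd ℂ (h y)) = cexpSq m μ h := by simp [cexpSq]
  filter_upwards [condLExp_enorm_mul_lt_top (m := m) (g := f) hT.aestronglyMeasurable_conj,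
    hT.cexpSq_lt_top, cexpSq_lt_top_of_memLp (m := m) hf] with x h1 h2 h3
  exact h1 (hsq ▸ h2) h3

variable (hm : m ≤ m0) [SigmaFinite (μ.trim hm)]
include hm

/-- Pull-out under `E`. No bound on `b` is needed, since `b f` is given as an element of `L²`. -/
theorem apply_mul (hT : IsNormalForm m μ T φ h) (hb : Measurable[m] b) {f g : Lp ℂ 2 μ}
    (hg : g =ᵐ[μ] fun x => b x * f x) : T g =ᵐ[μ] fun x => b x * T f x := by
  have hmeas : AEStronglyMeasurable (fun y => starRingEnd ℂ (h y) * f y) μ :=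
    hT.aestronglyMeasurable_conj.mul (Lp.aestronglyMeasurable f)
  have hcongr : (fun y => starRingEnd ℂ (h y) * g y)
      =ᵐ[μ] fun y => b y * (starRingEnd ℂ (h y) * f y) := hg.mono fun x hx => by
    simp only [hx, mul_left_comm]
  filter_upwards [hT.apply_ae f, hT.apply_ae g, cexp_congr_ae (m := m) hcongr,
    cexp_mul_left hm hb hmeas, hT.condLExp_lt_top (Lp.memLp f)] with x h1 h2 h3 h4 h5
  rw [h1, h2, h3, h4 h5]
  ring

/-- Pulling `φ E(h̄ f)` out of `E(h̄ T f)` leaves `E(|h|²)`, which is `1` where `φ ≠ 0`; where `φ =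
0` both sides vanish. -/
theorem apply_apply (hT : IsNormalForm m μ T φ h) (f : Lp ℂ 2 μ) :
    T (T f) =ᵐ[μ] fun x => φ x * T f x := by
  set Λ := cexp m μ fun y => starRingEnd ℂ (h y) * f y with hΛ
  have hcongr : (fun y => starRingEnd ℂ (h y) * T f y)
      =ᵐ[μ] fun y => (φ y * Λ y) * (h y * starRingEnd ℂ (h y)) :=
    (hT.apply_ae f).mono fun x hx => by
      simp only [hx]
      ring
  have hsq : (fun y => ‖h y * starRingEnd ℂ (h y)‖ₑ) = fun y => ‖h y‖ₑ ^ 2 := by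
    funext y
    rw [enorm_mul, RCLike.enorm_conj, sq]
  have hmeas : AEStronglyMeasurable (fun y => h y * starRingEnd ℂ (h y)) μ :=
    hT.aestronglyMeasurable.mul hT.aestronglyMeasurable_conj
  have hmul := cexp_mul_left (a := fun y => φ y * Λ y) hm
    (hT.measurable.mul (measurable_cexp _)) hmeas
  filter_upwards [hT.apply_ae f, hT.apply_ae (T f), cexp_congr_ae (m := m) hcongr, hmul,
    hT.cexpSq_lt_top, hT.cexpSq_eq_one] with x h1 h2 h3 h4 h5 h6
  have h4' : cexp m μ (fun y => (φ y * Λ y) * (h y * starRingEnd ℂ (h y))) x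
      = φ x * Λ x * (cexpSq m μ h x).toReal := by
    rw [← cexp_norm_sq]
    exact h4 (by rw [hsq]; exact h5)
  rw [h2, h3, h4', h1]
  by_cases h0 : φ x = 0
  · simp [h0]
  · rw [h6 h0]
    simp only [ENNReal.toReal_one, Complex.ofReal_one]
    ring

/-- Since `Tⁿ⁺¹ = φⁿ T`, the Neumann series formally sums to this expression. It is checked directly
as a right inverse, and commutation of `T` with multiplication by `b` makes it a left inverse. -/
theorem resolvent_eq (hT : IsNormalForm m μ T φ h) (hz : z ≠ 0) (hb : Measurable[m] b)
    (hC : ∀ᵐ x ∂μ, ‖b x‖ ≤ C) (hzb : ∀ᵐ x ∂μ, (z - φ x) * b x = 1) :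
    z ∈ resolventSet ℂ T ∧ resolvent T z = z⁻¹ • (1 + T * mulOp μ b) := by
  have hM (f : Lp ℂ 2 μ) := mulOp_apply_ae (hb.mono hm le_rfl).aestronglyMeasurable hC f
  have hTM (f : Lp ℂ 2 μ) : T (mulOp μ b f) =ᵐ[μ] fun x => b x * T f x :=
    hT.apply_mul hm hb (hM f)
  have hcomm : Commute T (mulOp μ b) :=
    ContinuousLinearMap.ext fun f => Lp.ext ((hTM f).trans (hM (T f)).symm)
  have hinv : z • (T * mulOp μ b) - T - T * (T * mulOp μ b) = 0 := by
    refine ContinuousLinearMap.ext fun f => Lp.ext ?_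
    change (z • T (mulOp μ b f) - T f - T (T (mulOp μ b f)) : Lp ℂ 2 μ) =ᵐ[μ] (0 : Lp ℂ 2 μ)
    filter_upwards [Lp.coeFn_sub (z • T (mulOp μ b f) - T f) (T (T (mulOp μ b f))),
      Lp.coeFn_sub (z • T (mulOp μ b f)) (T f), Lp.coeFn_smul z (T (mulOp μ b f)),
      Lp.coeFn_zero ℂ 2 μ, hTM f, hT.apply_apply hm (mulOp μ b f), hzb] with x h1 h2 h3 h4 h5 h6 h7
    rw [h1, Pi.sub_apply, h2, Pi.sub_apply, h3, Pi.smul_apply, h4, h6, h5, smul_eq_mul,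
      Pi.zero_apply]
    linear_combination T f x * h7
  have hright : (algebraMap ℂ _ z - T) * (z⁻¹ • (1 + T * mulOp μ b)) = 1 := by
    have : (algebraMap ℂ _ z - T) * (1 + T * mulOp μ b) = z • 1 := by
      rw [Algebra.algebraMap_eq_smul_one, sub_mul, smul_one_mul, mul_add, mul_one, smul_add,
        ← sub_eq_zero, ← hinv]
      abel
    rw [mul_smul_comm, this, inv_smul_smul₀ hz]
  have hleft : (z⁻¹ • (1 + T * mulOp μ b)) * (algebraMap ℂ _ z - T) = 1 := by
    refine Eq.trans ?_ hright
    have h1 : Commute T (z⁻¹ • (1 + T * mulOp μ b)) :=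
      ((Commute.one_right T).add_right ((Commute.refl T).mul_right hcomm)).smul_right _
    exact (((Algebra.commute_algebraMap_left z (z⁻¹ • (1 + T * mulOp μ b))).sub_left h1).eq).symm
  have hmem := spectrum.mem_resolventSet_of_left_right_inverse hright hleft
  refine ⟨hmem, ?_⟩
  have hunit : IsUnit (algebraMap ℂ (Lp ℂ 2 μ →L[ℂ] Lp ℂ 2 μ) z - T) := hmem
  rw [resolvent, ← Ring.inverse_mul_cancel_left _ (z⁻¹ • (1 + T * mulOp μ b)) hunit, hright,
    mul_one]

/-- The spectral projection of an operator in normal form at `z₀`, expressed through the operator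
and the fiber of `φ` over `z₀`. -/
noncomputable def fiberProj (μ : Measure X) (T : Lp ℂ 2 μ →L[ℂ] Lp ℂ 2 μ) (φ : X → ℂ) (z₀ : ℂ) :
    Lp ℂ 2 μ →L[ℂ] Lp ℂ 2 μ :=
  z₀⁻¹ • (T * mulOp μ ({x | φ x = z₀}.indicator 1))

theorem fiberProj_apply_ae (hT : IsNormalForm m μ T φ h) (h0 : z₀ ≠ 0) (f : Lp ℂ 2 μ) :
    fiberProj μ T φ z₀ f =ᵐ[μ] {x | φ x = z₀}.indicator
      fun x => h x * cexp m μ (fun y => starRingEnd ℂ (h y) * f y) x := by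
  have hs : MeasurableSet[m] {x | φ x = z₀} := hT.measurable (measurableSet_singleton z₀)
  have hb : Measurable[m] ({x | φ x = z₀}.indicator (1 : X → ℂ)) :=
    (@measurable_const _ _ _ m (1 : ℂ)).indicator hs
  have hC : ∀ᵐ x ∂μ, ‖{x | φ x = z₀}.indicator (1 : X → ℂ) x‖ ≤ 1 :=
    Eventually.of_forall fun x => by
      by_cases hx : x ∈ {x | φ x = z₀} <;> simp [hx]
  filter_upwards [Lp.coeFn_smul z₀⁻¹ (T (mulOp μ ({x | φ x = z₀}.indicator 1) f)),
    hT.apply_mul hm hb (mulOp_apply_ae (hb.mono hm le_rfl).aestronglyMeasurable hC f),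
    hT.apply_ae f] with x h1 h2 h3
  change (z₀⁻¹ • T (mulOp μ ({x | φ x = z₀}.indicator 1) f) : Lp ℂ 2 μ) x = _
  rw [h1, Pi.smul_apply, h2, h3]
  by_cases hx : φ x = z₀
  · simp [hx, h0]
  · simp [hx]

/-- On the range of `T`, `T` acts as multiplication by `φ`, and the functions produced here are
supported where `φ = z₀`. -/
theorem mul_fiberProj (hT : IsNormalForm m μ T φ h) (h0 : z₀ ≠ 0) :
    T * fiberProj μ T φ z₀ = z₀ • fiberProj μ T φ z₀ := by
  set M := mulOp μ ({x | φ x = z₀}.indicator (1 : X → ℂ)) with hM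
  refine ContinuousLinearMap.ext fun f => ?_
  have hkey : T (T (M f)) = z₀ • T (M f) := by
    refine Lp.ext ?_
    have hP : fiberProj μ T φ z₀ f = z₀⁻¹ • T (M f) := rfl
    have hPz : T (M f) = z₀ • fiberProj μ T φ z₀ f := by rw [hP, smul_inv_smul₀ h0]
    filter_upwards [hT.apply_apply hm (M f), Lp.coeFn_smul z₀ (T (M f)),
      hT.fiberProj_apply_ae hm h0 f, Lp.coeFn_smul z₀ (fiberProj μ T φ z₀ f)] with x h1 h2 h3 h4
    rw [h1, h2, Pi.smul_apply, smul_eq_mul, hPz, h4, Pi.smul_apply, h3]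
    by_cases hx : φ x = z₀ <;> simp [hx]
  change T (z₀⁻¹ • T (M f)) = z₀ • z₀⁻¹ • T (M f)
  rw [map_smul, hkey, smul_comm]

theorem fiberProj_ne_zero (hT : IsNormalForm m μ T φ h) (h0 : z₀ ≠ 0)
    (hpos : μ {x | φ x = z₀} ≠ 0) : fiberProj μ T φ z₀ ≠ 0 := by
  intro hzero
  refine hpos (measure_eq_zero_iff_ae_notMem.2 ?_)
  obtain ⟨B, hB, -, hBi, hBc⟩ := exists_cover_condLExp_lt_top (μ := μ) hm fun y => ‖h y‖ₑ ^ 2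
  have hs : MeasurableSet[m] {x | φ x = z₀} := hT.measurable (measurableSet_singleton z₀)
  have key (n : ℕ × ℕ) : ∀ᵐ x ∂μ, x ∉ B n ∩ {x | φ x = z₀} := by
    set s := B n ∩ {x | φ x = z₀} with hs_def
    have hsm : MeasurableSet[m] s := (hB n).inter hs
    -- The test vector is `h` cut to a piece of the fiber, as `h` itself need not be in `L²`. The
    -- projection maps it to `h E(|h|²) = h` on `s`; if that were zero, `E(|h|²)` would vanish on
    -- `s`, where it equals `1`.
    have hmem : MemLp (s.indicator h) 2 μ := by
      refine ⟨hT.aestronglyMeasurable.indicator (hm _ hsm), ?_⟩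
      rw [eLpNorm_lt_top_iff_lintegral_rpow_enorm_lt_top two_ne_zero ENNReal.ofNat_ne_top]
      have : (fun x => ‖s.indicator h x‖ₑ ^ (2 : ℝ≥0∞).toReal)
          = s.indicator fun x => ‖h x‖ₑ ^ 2 := by
        funext x
        by_cases hx : x ∈ s <;> simp [hx]
      rw [this, lintegral_indicator (hm _ hsm)]
      exact (lintegral_mono_set Set.inter_subset_left).trans_lt (hBi n)
    have hcongr : ∀ᵐ x ∂μ, x ∈ s →
        starRingEnd ℂ (h x) * hmem.toLp _ x = h x * starRingEnd ℂ (h x) := by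
      filter_upwards [hmem.coeFn_toLp] with x hx hxs
      rw [hx, Set.indicator_of_mem hxs, mul_comm]
    have hzero' : fiberProj μ T φ z₀ (hmem.toLp _) =ᵐ[μ] fun _ => 0 := by
      rw [hzero]
      exact Lp.coeFn_zero ℂ 2 μ
    have hh : ∀ᵐ x ∂μ, x ∈ s → ‖h x‖ₑ ^ 2 = 0 := by
      filter_upwards [hzero', hT.fiberProj_apply_ae hm h0 (hmem.toLp _),
        cexp_congr_on hm hsm hcongr, hT.cexpSq_eq_one] with x h1 h2 h3 h4 hx
      have hxφ : φ x = z₀ := hx.2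
      rw [h1, Set.indicator_of_mem hx.2, h3 hx, cexp_norm_sq, h4 (hxφ ▸ h0)] at h2
      simpa using h2.symm
    filter_upwards [condLExp_congr_on (g := fun _ => 0) hm hsm hh, hT.cexpSq_eq_one]
      with x h1 h2 hx
    have hxφ : φ x = z₀ := hx.2
    have h3 : condLExp m μ (fun _ => 0) x = 0 := congrFun (condLExp_zero (mΩ := m) μ) x
    have h4 := h2 (hxφ ▸ h0)
    rw [cexpSq, h1 hx, h3] at h4
    exact zero_ne_one h4
  filter_upwards [ae_all_iff.2 key, hT.cexpSq_lt_top] with x h1 h2 hx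
  obtain ⟨n, hn⟩ := hBc x h2
  exact h1 n ⟨hn, hx⟩

/-- Conditioning preserves the integral, and `conj E(h̄ f)` pulls out. The resulting form is visibly
Hermitian in `f` and `g`, which gives self-adjointness. -/
theorem inner_fiberProj_left (hT : IsNormalForm m μ T φ h) (h0 : z₀ ≠ 0) (f g : Lp ℂ 2 μ) :
    inner ℂ (fiberProj μ T φ z₀ f) g = ∫ x, {x | φ x = z₀}.indicator (fun x =>
      starRingEnd ℂ (cexp m μ (fun y => starRingEnd ℂ (h y) * f y) x) *
        cexp m μ (fun y => starRingEnd ℂ (h y) * g y) x) x ∂μ := by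
  have hs : MeasurableSet[m] {x | φ x = z₀} := hT.measurable (measurableSet_singleton z₀)
  set Λ := cexp m μ fun y => starRingEnd ℂ (h y) * f y with hΛ
  have hΛm : Measurable[m] ({x | φ x = z₀}.indicator fun x => starRingEnd ℂ (Λ x)) :=
    (Complex.continuous_conj.measurable.comp (measurable_cexp _)).indicator hs
  have hmeas : AEStronglyMeasurable (fun y => starRingEnd ℂ (h y) * g y) μ :=
    hT.aestronglyMeasurable_conj.mul (Lp.aestronglyMeasurable g)
  have hcongr : (fun x => inner ℂ (fiberProj μ T φ z₀ f x) (g x)) =ᵐ[μ] fun x =>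
      {x | φ x = z₀}.indicator (fun x => starRingEnd ℂ (Λ x)) x *
        (starRingEnd ℂ (h x) * g x) := by
    filter_upwards [hT.fiberProj_apply_ae hm h0 f] with x hx
    rw [hx, RCLike.inner_apply]
    by_cases hxs : φ x = z₀
    · simp only [Set.indicator_of_mem (show x ∈ {x | φ x = z₀} from hxs), map_mul]
      ring
    · simp [hxs]
  rw [L2.inner_def, integral_congr_ae hcongr,
    ← integral_cexp hm ((L2.integrable_inner (𝕜 := ℂ) _ g).congr hcongr)]
  refine integral_congr_ae ?_
  filter_upwards [cexp_mul_left hm hΛm hmeas, hT.condLExp_lt_top (Lp.memLp g)] with x h1 h2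
  rw [h1 h2]
  by_cases hxs : φ x = z₀ <;> simp [hxs]

theorem isSelfAdjoint_fiberProj (hT : IsNormalForm m μ T φ h) (h0 : z₀ ≠ 0) :
    IsSelfAdjoint (fiberProj μ T φ z₀) := by
  rw [ContinuousLinearMap.isSelfAdjoint_iff_isSymmetric]
  intro f g
  change inner ℂ (fiberProj μ T φ z₀ f) g = inner ℂ f (fiberProj μ T φ z₀ g)
  rw [← inner_conj_symm f, hT.inner_fiberProj_left hm h0, hT.inner_fiberProj_left hm h0,
    ← integral_conj]
  congr 1 with x
  by_cases hxs : φ x = z₀ <;> simp [hxs, mul_comm]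

/-- The multiplier `(z - z₀) / (z - φ)` is `1` on the fiber. Off it, `‖z - z₀‖ < δ / 2` forces `‖z -
φ‖ ≥ δ / 2`, so the multiplier is at most `‖z - z₀‖ * (2 / δ)`. -/
theorem eventually_resolvent (hT : IsNormalForm m μ T φ h) (h0 : z₀ ≠ 0) {δ : ℝ} (hδ : 0 < δ)
    (hgap : ∀ᵐ x ∂μ, φ x = z₀ ∨ δ ≤ ‖φ x - z₀‖) :
    ∀ᶠ z in 𝓝[≠] z₀, z ∈ resolventSet ℂ T ∧
      ‖(z - z₀) • mulOp μ (fun x => (z - φ x)⁻¹) - mulOp μ ({x | φ x = z₀}.indicator 1)‖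
        ≤ ‖z - z₀‖ * (2 / δ) ∧
      resolvent T z = z⁻¹ • (1 + T * mulOp μ fun x => (z - φ x)⁻¹) := by
  have hs : MeasurableSet[m] {x | φ x = z₀} := hT.measurable (measurableSet_singleton z₀)
  have he : Measurable[m] ({x | φ x = z₀}.indicator (1 : X → ℂ)) :=
    (@measurable_const _ _ _ m (1 : ℂ)).indicator hs
  have he1 : ∀ᵐ x ∂μ, ‖{x | φ x = z₀}.indicator (1 : X → ℂ) x‖ ≤ 1 :=
    Eventually.of_forall fun x => by
      by_cases hx : x ∈ {x | φ x = z₀} <;> simp [hx]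
  have hball : ∀ᶠ z in 𝓝[≠] z₀, ‖z - z₀‖ < δ / 2 := by
    refine mem_nhdsWithin_of_mem_nhds ?_
    filter_upwards [Metric.ball_mem_nhds z₀ (half_pos hδ)] with z hz
    rwa [← dist_eq_norm]
  filter_upwards [hball, self_mem_nhdsWithin,
    mem_nhdsWithin_of_mem_nhds (isOpen_ne.mem_nhds h0)] with z hz hne hz0
  have hzz : 0 < ‖z - z₀‖ := norm_pos_iff.2 (sub_ne_zero.2 hne)
  have hfar : ∀ x, δ ≤ ‖φ x - z₀‖ → δ / 2 ≤ ‖z - φ x‖ := fun x hx => by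
    have : ‖φ x - z₀‖ ≤ ‖z - φ x‖ + ‖z - z₀‖ := by
      rw [norm_sub_rev z (φ x)]
      exact norm_sub_le_norm_sub_add_norm_sub _ _ _
    linarith
  have hlow : ∀ᵐ x ∂μ, ‖z - z₀‖ ≤ ‖z - φ x‖ := hgap.mono fun x hx =>
    hx.elim (fun h => by rw [h]) fun h => hz.le.trans (hfar x h)
  have hg : Measurable[m] fun x => (z - φ x)⁻¹ := (hT.measurable.const_sub z).inv
  have hgC : ∀ᵐ x ∂μ, ‖(z - φ x)⁻¹‖ ≤ ‖z - z₀‖⁻¹ := hlow.mono fun x hx => by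
    rw [norm_inv]
    exact inv_anti₀ hzz hx
  have hg1 : ∀ᵐ x ∂μ, (z - φ x) * (z - φ x)⁻¹ = 1 := hlow.mono fun x hx =>
    mul_inv_cancel₀ (norm_pos_iff.1 (hzz.trans_le hx))
  obtain ⟨hmem, hres⟩ := hT.resolvent_eq hm hz0 hg hgC hg1
  refine ⟨hmem, ContinuousLinearMap.opNorm_le_bound _ (by positivity) fun f => ?_, hres⟩
  refine Lp.norm_le_mul_norm_of_ae_le_mul ?_
  set M := mulOp μ fun x => (z - φ x)⁻¹
  set N := mulOp μ ({x | φ x = z₀}.indicator (1 : X → ℂ))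
  change ∀ᵐ x ∂μ, ‖((z - z₀) • M f - N f : Lp ℂ 2 μ) x‖ ≤ _
  filter_upwards [Lp.coeFn_sub ((z - z₀) • M f) (N f), Lp.coeFn_smul (z - z₀) (M f),
    mulOp_apply_ae (hg.mono hm le_rfl).aestronglyMeasurable hgC f,
    mulOp_apply_ae (he.mono hm le_rfl).aestronglyMeasurable he1 f, hgap] with x h1 h2 h3 h4 h5
  rw [h1, Pi.sub_apply, h2, Pi.smul_apply, h3, h4, smul_eq_mul, ← mul_assoc, ← sub_mul, norm_mul]
  refine mul_le_mul_of_nonneg_right ?_ (norm_nonneg _)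
  by_cases hx : φ x = z₀
  · rw [Set.indicator_of_mem (show x ∈ {x | φ x = z₀} from hx), hx,
      mul_inv_cancel₀ (sub_ne_zero.2 hne), Pi.one_apply, sub_self, norm_zero]
    positivity
  · rw [Set.indicator_of_notMem (show x ∉ {x | φ x = z₀} from hx), sub_zero, norm_mul, norm_inv]
    refine mul_le_mul_of_nonneg_left ?_ (norm_nonneg _)
    rw [← inv_div]
    exact inv_anti₀ (half_pos hδ) (hfar x (h5.resolve_left hx))

theorem tendsto_smul_resolvent (hT : IsNormalForm m μ T φ h) (h0 : z₀ ≠ 0) {δ : ℝ} (hδ : 0 < δ)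
    (hgap : ∀ᵐ x ∂μ, φ x = z₀ ∨ δ ≤ ‖φ x - z₀‖) :
    Tendsto (fun z => (z - z₀) • resolvent T z) (𝓝[≠] z₀) (𝓝 (fiberProj μ T φ z₀)) := by
  have hev := hT.eventually_resolvent hm h0 hδ hgap
  have hid : Tendsto (fun z : ℂ => z) (𝓝[≠] z₀) (𝓝 z₀) := tendsto_id.mono_left nhdsWithin_le_nhds
  have hsub : Tendsto (fun z : ℂ => z - z₀) (𝓝[≠] z₀) (𝓝 0) := by
    simpa using hid.sub_const z₀
  have hM : Tendsto (fun z => (z - z₀) • mulOp μ fun x => (z - φ x)⁻¹) (𝓝[≠] z₀)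
      (𝓝 (mulOp μ ({x | φ x = z₀}.indicator 1))) := by
    rw [tendsto_iff_norm_sub_tendsto_zero]
    refine squeeze_zero' (Eventually.of_forall fun z => norm_nonneg _)
      (hev.mono fun z hz => hz.2.1) ?_
    simpa using hsub.norm.mul_const (2 / δ)
  have hlim := (hid.inv₀ h0).smul ((hsub.smul_const (1 : Lp ℂ 2 μ →L[ℂ] Lp ℂ 2 μ)).add
    (hM.const_mul T))
  rw [zero_smul, zero_add] at hlim
  refine hlim.congr' ?_
  filter_upwards [hev] with z hz
  rw [hz.2.2, smul_comm, smul_add, mul_smul_comm, ← smul_add, ← smul_add]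

theorem isSimplePoleOfResolvent (hT : IsNormalForm m μ T φ h) (h0 : z₀ ≠ 0)
    (hiso : IsIsolatedPt (essRange μ φ) z₀) : IsSimplePoleOfResolvent T z₀ := by
  have hφ : Measurable φ := hT.measurable.mono hm le_rfl
  obtain ⟨δ, hδ, hgap⟩ := hiso.exists_ae_eq_or_le_norm_sub hφ
  exact isSimplePoleOfResolvent_of_tendsto
    (hT.fiberProj_ne_zero hm h0 (hiso.measure_fiber_ne_zero hφ)) (hT.mul_fiberProj hm h0)
    ((hT.eventually_resolvent hm h0 hδ hgap).mono fun z hz => hz.1)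
    (hT.tendsto_smul_resolvent hm h0 hδ hgap)

theorem isSelfAdjoint_rieszIdempotent (hT : IsNormalForm m μ T φ h) (h0 : z₀ ≠ 0)
    (hiso : IsIsolatedPt (essRange μ φ) z₀) {r : ℝ} (hr : 0 < r)
    (hspec : Metric.closedBall z₀ r ∩ spectrum ℂ T = {z₀}) :
    IsSelfAdjoint (rieszIdempotent T z₀ r) := by
  obtain ⟨δ, hδ, hgap⟩ := hiso.exists_ae_eq_or_le_norm_sub (hT.measurable.mono hm le_rfl)
  rw [rieszIdempotent_eq_of_tendsto hr hspec (hT.tendsto_smul_resolvent hm h0 hδ hgap)]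
  exact hT.isSelfAdjoint_fiberProj hm h0

/-- Together with `T`, the operator `f ↦ φ̄ h E(h̄ f)` is bounded, and it acts as multiplication by
`z̄₀` on the eigenvectors of `T` for `z₀ ≠ 0`. -/
theorem exists_conj (hT : IsNormalForm m μ T φ h) :
    ∃ S : Lp ℂ 2 μ →L[ℂ] Lp ℂ 2 μ,
      (∀ f : Lp ℂ 2 μ, S f =ᵐ[μ] fun x => starRingEnd ℂ (φ x) *
        (h x * cexp m μ (fun y => starRingEnd ℂ (h y) * f y) x)) ∧
      ∀ z₀ : ℂ, z₀ ≠ 0 → ∀ f : Lp ℂ 2 μ, T f = z₀ • f → S f = starRingEnd ℂ z₀ • f := by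
  have hφ : Measurable φ := hT.measurable.mono hm le_rfl
  -- The phase `φ̄ / φ`, equal to `0` where `φ = 0` by the division convention, is bounded by `1`
  -- and turns `φ` into `φ̄` everywhere.
  have hb : Measurable fun x => starRingEnd ℂ (φ x) / φ x :=
    (Complex.continuous_conj.measurable.comp hφ).div hφ
  have hC : ∀ᵐ x ∂μ, ‖starRingEnd ℂ (φ x) / φ x‖ ≤ 1 := Eventually.of_forall fun x => by
    rw [norm_div, RCLike.norm_conj]
    exact div_self_le_one _
  have hS (f : Lp ℂ 2 μ) : (mulOp μ (fun x => starRingEnd ℂ (φ x) / φ x) * T) f =ᵐ[μ]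
      fun x => starRingEnd ℂ (φ x) / φ x * T f x := mulOp_apply_ae hb.aestronglyMeasurable hC (T f)
  refine ⟨mulOp μ (fun x => starRingEnd ℂ (φ x) / φ x) * T, fun f => ?_, fun z₀ h0 f hf => ?_⟩
  · filter_upwards [hS f, hT.apply_ae f] with x h1 h2
    rw [h1, h2]
    by_cases hx : φ x = 0
    · simp [hx]
    · rw [← mul_assoc, div_mul_cancel₀ _ hx]
  · refine Lp.ext ?_
    -- Computing `T² f` both as `z₀ T f` and as `φ T f` shows `φ = z₀` wherever `f ≠ 0`.
    have hTT : T (T f) =ᵐ[μ] (z₀ • T f : Lp ℂ 2 μ) := by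
      conv_lhs => rw [hf, map_smul]
    filter_upwards [hS f, hTT, hT.apply_apply hm f, Lp.coeFn_smul z₀ (T f), Lp.coeFn_smul z₀ f,
      Lp.coeFn_smul (starRingEnd ℂ z₀) f] with x h1 h2 h3 h4 h5 h6
    rw [h2, h4, hf, Pi.smul_apply, h5, Pi.smul_apply, smul_eq_mul, smul_eq_mul] at h3
    rw [h1, h6, hf, h5, Pi.smul_apply, Pi.smul_apply, smul_eq_mul, smul_eq_mul]
    by_cases hx : f x = 0
    · simp [hx]
    · rw [← mul_right_cancel₀ (mul_ne_zero h0 hx) h3]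
      field_simp

end IsNormalForm

/-! ### Reduction of `M_w E M_u` and its conjugate to normal form. -/

section NormalForm

variable {X : Type*} {m m0 : MeasurableSpace X} {μ : Measure X}

/-- Finiteness is part of the conclusion so that the lemma can be iterated along the expansion of a
square. -/
theorem cexp_add_mul (hm : m ≤ m0) [SigmaFinite (μ.trim hm)] {a f g : X → ℂ}
    (ha : Measurable[m] a) (hf : AEStronglyMeasurable f μ) (hg : AEStronglyMeasurable g μ) :
    ∀ᵐ x ∂μ, condLExp m μ (fun y => ‖f y‖ₑ) x < ∞ → condLExp m μ (fun y => ‖g y‖ₑ) x < ∞ →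
      condLExp m μ (fun y => ‖f y + a y * g y‖ₑ) x < ∞ ∧
        cexp m μ (fun y => f y + a y * g y) x = cexp m μ f x + a x * cexp m μ g x := by
  have hag : AEStronglyMeasurable (fun y => a y * g y) μ :=
    (ha.mono hm le_rfl).aestronglyMeasurable.mul hg
  have hle : (fun y => ‖f y + a y * g y‖ₑ) ≤ᵐ[μ]
      (fun y => ‖f y‖ₑ) + fun y => ‖a y‖ₑ * ‖g y‖ₑ :=
    Eventually.of_forall fun y => (enorm_add_le _ _).trans_eq (by rw [enorm_mul]; rfl)
  have ha' : Measurable[m] fun y => ‖a y‖ₑ := measurable_enorm.comp ha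
  filter_upwards [condLExp_mono (mΩ := m) hle,
    condLExp_add_left (mΩ := m) (fun y => ‖a y‖ₑ * ‖g y‖ₑ) hf.enorm,
    condLExp_mul_left hm ha' hg.enorm, cexp_add hm hf hag, cexp_mul_left hm ha hg]
    with x h1 h2 h3 h4 h5 hfx hgx
  have hagx : condLExp m μ (fun y => ‖a y‖ₑ * ‖g y‖ₑ) x < ∞ := by
    rw [h3]
    exact ENNReal.mul_lt_top enorm_lt_top hgx
  refine ⟨h1.trans_lt ?_, ?_⟩
  · rw [h2]
    exact ENNReal.add_lt_top.2 ⟨hfx, hagx⟩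
  · rw [h4 hfx (by simpa only [enorm_mul] using hagx), h5 hgx]

/-- `E(|w|²)^(-1/2)`, and `0` where `E(|w|²)` is `0` or `∞`. -/
noncomputable def normalizer (m : MeasurableSpace X) {m0 : MeasurableSpace X} (μ : Measure X)
    (w : X → ℂ) (x : X) : ℝ :=
  (√(cexpSq m μ w x).toReal)⁻¹

theorem measurable_cexpSq (w : X → ℂ) : Measurable[m] (cexpSq m μ w) :=
  measurable_condLExp m μ _

theorem measurable_normalizer (w : X → ℂ) :
    Measurable[m] fun x => (normalizer m μ w x : ℂ) :=
  Complex.measurable_ofReal.comp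
    ((Real.continuous_sqrt.measurable.comp (measurable_cexpSq w).ennreal_toReal).inv)

theorem normalizer_ne_zero_iff {w : X → ℂ} {x : X} :
    normalizer m μ w x ≠ 0 ↔ cexpSq m μ w x ≠ 0 ∧ cexpSq m μ w x ≠ ∞ := by
  rw [normalizer, ne_eq, inv_eq_zero, ← ne_eq, Real.sqrt_ne_zero ENNReal.toReal_nonneg, ENNReal.toReal_ne_zero]

theorem normalizer_sq_mul {w : X → ℂ} {x : X} (h : normalizer m μ w x ≠ 0) :
    normalizer m μ w x ^ 2 * (cexpSq m μ w x).toReal = 1 := by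
  have h1 := ENNReal.toReal_ne_zero.2 (normalizer_ne_zero_iff.1 h)
  rw [normalizer, inv_pow, Real.sq_sqrt ENNReal.toReal_nonneg, inv_mul_cancel₀ h1]

variable {u w : X → ℂ} (hm : m ≤ m0) [SigmaFinite (μ.trim hm)]
include hm

theorem ae_eq_zero_of_cexpSq_eq_zero (hw : AEStronglyMeasurable w μ) :
    ∀ᵐ x ∂μ, cexpSq m μ w x = 0 → w x = 0 := by
  filter_upwards [ae_eq_zero_of_condLExp_eq_zero hm (hw.enorm.pow_const 2)] with x hx h
  simpa using hx h

/-- The right side of the inequality is finite, so `E(|w|²) = ∞` forces `E(|u|²) = 0`. -/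
theorem ae_eq_zero_of_cexpSq_eq_top (hu : AEStronglyMeasurable u μ)
    (hG : ∀ᵐ x ∂μ, cexpSq m μ w x ≠ 0 → cexpSq m μ u x * cexpSq m μ w x
      ≤ ‖cexp m μ (fun y => u y * w y) x‖ₑ ^ 2) :
    ∀ᵐ x ∂μ, cexpSq m μ w x = ∞ → u x = 0 := by
  filter_upwards [hG, ae_eq_zero_of_cexpSq_eq_zero hm hu] with x h1 h2 h3
  refine h2 (by_contra fun h4 => ?_)
  have h5 := h1 (h3 ▸ ENNReal.top_ne_zero)
  rw [h3, ENNReal.mul_top h4] at h5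
  exact (ENNReal.pow_lt_top enorm_lt_top).not_ge h5

theorem cexp_mul_eq_zero_of_normalizer_eq_zero (hu : AEStronglyMeasurable u μ)
    (hw : AEStronglyMeasurable w μ)
    (hG : ∀ᵐ x ∂μ, cexpSq m μ w x ≠ 0 → cexpSq m μ u x * cexpSq m μ w x
      ≤ ‖cexp m μ (fun y => u y * w y) x‖ₑ ^ 2) :
    ∀ᵐ x ∂μ, normalizer m μ w x = 0 → cexp m μ (fun y => u y * w y) x = 0 := by
  have hs : MeasurableSet[m] {x | cexpSq m μ w x = 0 ∨ cexpSq m μ w x = ∞} :=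
    measurable_cexpSq w ((measurableSet_singleton 0).union (measurableSet_singleton ∞))
  have h0 : ∀ᵐ x ∂μ, x ∈ {x | cexpSq m μ w x = 0 ∨ cexpSq m μ w x = ∞} → u x * w x = 0 := by
    filter_upwards [ae_eq_zero_of_cexpSq_eq_zero hm hw, ae_eq_zero_of_cexpSq_eq_top hm hu hG]
      with x h1 h2 h3
    exact h3.elim (fun h => by rw [h1 h, mul_zero]) fun h => by rw [h2 h, zero_mul]
  filter_upwards [cexp_eq_zero_on hm hs h0] with x h1 h2
  refine h1 ?_
  by_contra! h3
  exact normalizer_ne_zero_iff.2 h3 h2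

/-- The case of equality in the conditional Cauchy-Schwarz inequality. -/
theorem eq_mul_conj_of_cexpSq_mul_le (hu : AEStronglyMeasurable u μ)
    (hw : AEStronglyMeasurable w μ)
    (hG : ∀ᵐ x ∂μ, cexpSq m μ w x ≠ 0 → cexpSq m μ u x * cexpSq m μ w x
      ≤ ‖cexp m μ (fun y => u y * w y) x‖ₑ ^ 2) :
    ∀ᵐ x ∂μ, normalizer m μ w x ≠ 0 →
      u x = cexp m μ (fun y => u y * w y) x * (normalizer m μ w x : ℂ) ^ 2
        * starRingEnd ℂ (w x) := by
  set φ := cexp m μ fun y => u y * w y with hφ_def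
  -- `ψ w̄` is the conditional orthogonal projection of `u` onto the multiples of `w̄`; the aim is
  -- `E(|u - ψ w̄|²) = 0`.
  set ψ : X → ℂ := fun x => φ x * (normalizer m μ w x : ℂ) ^ 2 with hψ_def
  have hψ : Measurable[m] ψ := (measurable_cexp _).mul ((measurable_normalizer w).pow_const 2)
  have hψc : Measurable[m] fun x => starRingEnd ℂ (ψ x) :=
    Complex.continuous_conj.measurable.comp hψ
  have conj_meas {f : X → ℂ} (hf : AEStronglyMeasurable f μ) :
      AEStronglyMeasurable (fun y => starRingEnd ℂ (f y)) μ :=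
    Complex.continuous_conj.comp_aestronglyMeasurable hf
  have huw : AEStronglyMeasurable (fun y => u y * w y) μ := hu.mul hw
  have huu : AEStronglyMeasurable (fun y => u y * starRingEnd ℂ (u y)) μ := hu.mul (conj_meas hu)
  have hww : AEStronglyMeasurable (fun y => w y * starRingEnd ℂ (w y)) μ := hw.mul (conj_meas hw)
  have hv : AEStronglyMeasurable (fun y => u y - ψ y * starRingEnd ℂ (w y)) μ :=
    hu.sub ((hψ.mono hm le_rfl).aestronglyMeasurable.mul (conj_meas hw))
  -- The four terms of `|u - ψ w̄|²` are added one at a time, to track finiteness of each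
  -- conditional expectation.
  set f₁ : X → ℂ := fun y => u y * starRingEnd ℂ (u y) + -starRingEnd ℂ (ψ y) * (u y * w y)
    with hf₁
  set f₂ : X → ℂ := fun y => f₁ y + -ψ y * starRingEnd ℂ (u y * w y) with hf₂
  set f₃ : X → ℂ := fun y => f₂ y + ψ y * starRingEnd ℂ (ψ y) * (w y * starRingEnd ℂ (w y))
    with hf₃
  have hf₁m : AEStronglyMeasurable f₁ μ :=
    huu.add ((hψc.neg.mono hm le_rfl).aestronglyMeasurable.mul huw)
  have hf₂m : AEStronglyMeasurable f₂ μ :=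
    hf₁m.add ((hψ.neg.mono hm le_rfl).aestronglyMeasurable.mul (conj_meas huw))
  have hexpand : f₃ = fun y => (u y - ψ y * starRingEnd ℂ (w y)) *
      starRingEnd ℂ (u y - ψ y * starRingEnd ℂ (w y)) := by
    funext y
    simp only [hf₃, hf₂, hf₁, map_sub, map_mul, Complex.conj_conj]
    ring
  have henorm (f : X → ℂ) : condLExp m μ (fun y => ‖f y * starRingEnd ℂ (f y)‖ₑ)
      = cexpSq m μ f := by
    simp only [enorm_mul, RCLike.enorm_conj, ← sq, cexpSq]
  filter_upwards [hG, condLExp_enorm_mul_lt_top (m := m) (g := w) hu,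
    cexp_add_mul hm hψc.neg huu huw, cexp_add_mul hm hψ.neg hf₁m (conj_meas huw),
    cexp_add_mul hm (hψ.mul hψc) hf₂m hww, ae_eq_zero_of_cexpSq_eq_zero hm hv]
    with x hGx huwx h1 h2 h3 h4 hκ
  obtain ⟨hW0, hWt⟩ := normalizer_ne_zero_iff.1 hκ
  have hbound := hGx hW0
  have hfin : ‖φ x‖ₑ ^ 2 < ∞ := ENNReal.pow_lt_top enorm_lt_top
  have hU : cexpSq m μ u x < ∞ := by
    by_contra hU
    rw [not_lt_top_iff.1 hU, ENNReal.top_mul hW0] at hbound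
    exact hfin.not_ge hbound
  have huwf := huwx hU (lt_top_iff_ne_top.2 hWt)
  obtain ⟨h1f, h1e⟩ := h1 (by rwa [henorm]) huwf
  obtain ⟨h2f, h2e⟩ := h2 h1f (by simpa only [RCLike.enorm_conj] using huwf)
  obtain ⟨h3f, h3e⟩ := h3 h2f (by rw [henorm]; exact lt_top_iff_ne_top.2 hWt)
  change condLExp m μ (fun y => ‖f₃ y‖ₑ) x < ∞ at h3f
  change cexp m μ f₃ x = cexp m μ f₂ x + _ at h3e
  change cexp m μ f₂ x = cexp m μ f₁ x + _ at h2e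
  change cexp m μ f₁ x = _ at h1e
  rw [hexpand, henorm] at h3f
  rw [h2e, h1e, hexpand, cexp_norm_sq, cexp_norm_sq, cexp_norm_sq, cexp_conj] at h3e
  have hκW := normalizer_sq_mul hκ
  have hreal : (cexpSq m μ u x).toReal * (cexpSq m μ w x).toReal ≤ ‖φ x‖ ^ 2 := by
    have := ENNReal.toReal_mono hfin.ne hbound
    simpa [ENNReal.toReal_mul] using this
  -- With `κ² E(|w|²) = 1`, the two cross terms and the last term combine to `-κ² |φ|²`.
  have hval : (cexpSq m μ (fun y => u y - ψ y * starRingEnd ℂ (w y)) x).toReal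
      = (cexpSq m μ u x).toReal - normalizer m μ w x ^ 2 * ‖φ x‖ ^ 2 := by
    have hκW' : (normalizer m μ w x : ℂ) ^ 2 * ((cexpSq m μ w x).toReal : ℂ) = 1 := by
      exact_mod_cast hκW
    have hφφ : φ x * starRingEnd ℂ (φ x) = (‖φ x‖ : ℂ) ^ 2 := Complex.mul_conj' _
    apply Complex.ofReal_injective
    rw [h3e]
    push_cast
    rw [← hφφ]
    simp only [hψ_def, map_mul, map_pow, Complex.conj_ofReal, Pi.mul_apply]
    change _ + -_ * φ x + -_ * starRingEnd ℂ (φ x) + _ = _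
    linear_combination φ x * starRingEnd ℂ (φ x) * (normalizer m μ w x : ℂ) ^ 2 * hκW'
  have hnonpos : (cexpSq m μ (fun y => u y - ψ y * starRingEnd ℂ (w y)) x).toReal ≤ 0 := by
    rw [hval, sub_nonpos]
    calc (cexpSq m μ u x).toReal
        = normalizer m μ w x ^ 2 * ((cexpSq m μ u x).toReal * (cexpSq m μ w x).toReal) := by
          linear_combination -(cexpSq m μ u x).toReal * hκW
      _ ≤ _ := mul_le_mul_of_nonneg_left hreal (sq_nonneg _)
  have hzero : cexpSq m μ (fun y => u y - ψ y * starRingEnd ℂ (w y)) x = 0 :=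
    -- `toReal` also sends `∞` to `0`; the finiteness carried through the expansion excludes that
    -- case.
    ((ENNReal.toReal_eq_zero_iff _).1 (hnonpos.antisymm ENNReal.toReal_nonneg)).resolve_right h3f.ne
  exact sub_eq_zero.1 (h4 hzero)

theorem normalizer_mul_cexp (hw : AEStronglyMeasurable w μ) (f : Lp ℂ 2 μ) :
    ∀ᵐ x ∂μ, normalizer m μ w x * w x *
        cexp m μ (fun y => starRingEnd ℂ (normalizer m μ w y * w y) * f y) x
      = (normalizer m μ w x : ℂ) ^ 2 * w x * cexp m μ (fun y => starRingEnd ℂ (w y) * f y) x := by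
  have hwc : AEStronglyMeasurable (fun y => starRingEnd ℂ (w y)) μ :=
    Complex.continuous_conj.comp_aestronglyMeasurable hw
  have hwf : AEStronglyMeasurable (fun y => starRingEnd ℂ (w y) * f y) μ :=
    hwc.mul (Lp.aestronglyMeasurable f)
  have heq : (fun y => starRingEnd ℂ (normalizer m μ w y * w y) * f y)
      = fun y => (normalizer m μ w y : ℂ) * (starRingEnd ℂ (w y) * f y) := by
    funext y
    rw [map_mul, Complex.conj_ofReal, mul_assoc]
  have hsq : cexpSq m μ (fun y => starRingEnd ℂ (w y)) = cexpSq m μ w := by simp [cexpSq]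
  filter_upwards [cexp_mul_left hm (measurable_normalizer w) hwf,
    condLExp_enorm_mul_lt_top (m := m) (g := f) hwc, cexpSq_lt_top_of_memLp (m := m) (Lp.memLp f)]
    with x h1 h2 h3
  by_cases hκ : normalizer m μ w x = 0
  · simp [hκ]
  · have hW := (normalizer_ne_zero_iff.1 hκ).2
    rw [heq, h1 (h2 (by rw [hsq]; exact lt_top_iff_ne_top.2 hW) h3)]
    ring

/-- Where `κ ≠ 0`, substitute `u = φ κ² w̄` and pull `φ κ²` out. Where `κ = 0`, either `E(|w|²) = 0`
and `w = 0`, or `E(|w|²) = ∞` and `u = 0`, so both sides vanish. -/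
theorem isNormalForm_of_isWeightedCondOp {T : Lp ℂ 2 μ →L[ℂ] Lp ℂ 2 μ}
    (hu : AEStronglyMeasurable u μ) (hw : AEStronglyMeasurable w μ)
    (hT : IsWeightedCondOp m μ w u T)
    (hG : ∀ᵐ x ∂μ, cexpSq m μ w x ≠ 0 → cexpSq m μ u x * cexpSq m μ w x
      ≤ ‖cexp m μ (fun y => u y * w y) x‖ₑ ^ 2) :
    IsNormalForm m μ T (cexp m μ fun y => u y * w y) fun x => normalizer m μ w x * w x := by
  set φ := cexp m μ fun y => u y * w y with hφ_def
  have hφ : Measurable[m] φ := measurable_cexp _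
  have hκm := measurable_normalizer (m := m) (μ := μ) w
  have hκe : Measurable[m] fun x => ‖(normalizer m μ w x : ℂ)‖ₑ ^ 2 :=
    (measurable_enorm.comp hκm).pow_const 2
  have hsq : ∀ᵐ x ∂μ, cexpSq m μ (fun x => normalizer m μ w x * w x) x
      = ‖(normalizer m μ w x : ℂ)‖ₑ ^ 2 * cexpSq m μ w x := by
    have := condLExp_mul_left hm hκe (hw.enorm.pow_const 2)
    simp only [cexpSq, enorm_mul, mul_pow]
    exact this
  have hone (x : X) (hκ : normalizer m μ w x ≠ 0) :
      ‖(normalizer m μ w x : ℂ)‖ₑ ^ 2 * cexpSq m μ w x = 1 := by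
    have hWt := (normalizer_ne_zero_iff.1 hκ).2
    rw [← ENNReal.toReal_eq_one_iff, ENNReal.toReal_mul, ENNReal.toReal_pow, toReal_enorm,
      Complex.norm_real, Real.norm_eq_abs, sq_abs, normalizer_sq_mul hκ]
  refine ⟨hφ, (hκm.mono hm le_rfl).aestronglyMeasurable.mul hw, ?_, ?_, fun f => ?_⟩
  · filter_upwards [hsq] with x hx
    rw [hx]
    by_cases hκ : normalizer m μ w x = 0
    · simp [hκ]
    · rw [hone x hκ]
      exact ENNReal.one_lt_top
  · filter_upwards [hsq, cexp_mul_eq_zero_of_normalizer_eq_zero hm hu hw hG] with x h1 h2 h3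
    rw [h1, hone x (mt h2 h3)]
  · have hD : MeasurableSet[m] {x | normalizer m μ w x ≠ 0} := by
      have : MeasurableSet[m] {x | (normalizer m μ w x : ℂ) = 0}ᶜ :=
        (hκm (measurableSet_singleton 0)).compl
      convert! this using 1
      ext x
      simp
    have htop : MeasurableSet[m] {x | cexpSq m μ w x = ∞} :=
      measurable_cexpSq w (measurableSet_singleton ∞)
    have huf : ∀ᵐ x ∂μ, x ∈ {x | normalizer m μ w x ≠ 0} → u x * f x
        = φ x * (normalizer m μ w x : ℂ) ^ 2 * (starRingEnd ℂ (w x) * f x) := by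
      filter_upwards [eq_mul_conj_of_cexpSq_mul_le hm hu hw hG] with x hx hκ
      rw [hx hκ, mul_assoc]
    have huf0 : ∀ᵐ x ∂μ, x ∈ {x | cexpSq m μ w x = ∞} → u x * f x = 0 := by
      filter_upwards [ae_eq_zero_of_cexpSq_eq_top hm hu hG] with x hx ht
      rw [hx ht, zero_mul]
    have hwc : AEStronglyMeasurable (fun y => starRingEnd ℂ (w y)) μ :=
      Complex.continuous_conj.comp_aestronglyMeasurable hw
    have hwf : AEStronglyMeasurable (fun y => starRingEnd ℂ (w y) * f y) μ :=
      hwc.mul (Lp.aestronglyMeasurable f)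
    have hsqc : cexpSq m μ (fun y => starRingEnd ℂ (w y)) = cexpSq m μ w := by simp [cexpSq]
    filter_upwards [(hT f).2, cexp_congr_on hm hD huf, cexp_eq_zero_on hm htop huf0,
      cexp_mul_left hm (hφ.mul (hκm.pow_const 2)) hwf, normalizer_mul_cexp hm hw f,
      condLExp_enorm_mul_lt_top (m := m) (g := f) hwc,
      cexpSq_lt_top_of_memLp (m := m) (Lp.memLp f), ae_eq_zero_of_cexpSq_eq_zero hm hw]
      with x h1 h2 h3 h4 h5 h6 h7 h8
    rw [h1, h5]
    by_cases hκ : normalizer m μ w x = 0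
    · rw [hκ, Complex.ofReal_zero, zero_pow two_ne_zero, zero_mul, zero_mul, mul_zero]
      by_cases hW : cexpSq m μ w x = 0
      · rw [h8 hW, zero_mul]
      · rw [h3 (by_contra fun ht => normalizer_ne_zero_iff.2 ⟨hW, ht⟩ hκ), mul_zero]
    · have hW := (normalizer_ne_zero_iff.1 hκ).2
      have h4' := h4 (h6 (by rw [hsqc]; exact lt_top_iff_ne_top.2 hW) h7)
      rw [h2 hκ]
      refine (congrArg (w x * ·) h4').trans ?_
      simp only [Pi.mul_apply]
      ring

/-- Where `u ≠ 0`, `E(|w|²)` is finite, so `E(|w̄ f|)` is finite exactly where the convention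
demands it. The formula follows by conjugating `u = φ κ² w̄`. -/
theorem isWeightedCondOp_conj {S : Lp ℂ 2 μ →L[ℂ] Lp ℂ 2 μ}
    (hu : AEStronglyMeasurable u μ) (hw : AEStronglyMeasurable w μ)
    (hG : ∀ᵐ x ∂μ, cexpSq m μ w x ≠ 0 → cexpSq m μ u x * cexpSq m μ w x
      ≤ ‖cexp m μ (fun y => u y * w y) x‖ₑ ^ 2)
    (hS : ∀ f : Lp ℂ 2 μ, S f =ᵐ[μ] fun x => starRingEnd ℂ (cexp m μ (fun y => u y * w y) x) *
      (normalizer m μ w x * w x *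
        cexp m μ (fun y => starRingEnd ℂ (normalizer m μ w y * w y) * f y) x)) :
    IsWeightedCondOp m μ (fun x => starRingEnd ℂ (u x)) (fun x => starRingEnd ℂ (w x)) S := by
  intro f
  have hwc : AEStronglyMeasurable (fun y => starRingEnd ℂ (w y)) μ :=
    Complex.continuous_conj.comp_aestronglyMeasurable hw
  have hsqc : cexpSq m μ (fun y => starRingEnd ℂ (w y)) = cexpSq m μ w := by simp [cexpSq]
  have hzero : MeasurableSet[m] {x | cexpSq m μ w x = 0} :=
    measurable_cexpSq w (measurableSet_singleton 0)
  have hwf0 : ∀ᵐ x ∂μ, x ∈ {x | cexpSq m μ w x = 0} → starRingEnd ℂ (w x) * f x = 0 := by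
    filter_upwards [ae_eq_zero_of_cexpSq_eq_zero hm hw] with x hx h0
    rw [hx h0, map_zero, zero_mul]
  refine ⟨?_, ?_⟩
  · filter_upwards [ae_eq_zero_of_cexpSq_eq_top hm hu hG,
      condLExp_enorm_mul_lt_top (m := m) (g := f) hwc,
      cexpSq_lt_top_of_memLp (m := m) (Lp.memLp f)] with x h1 h2 h3 h4
    refine h2 ?_ h3
    rw [hsqc, lt_top_iff_ne_top]
    exact fun ht => h4 (by rw [h1 ht, map_zero])
  · filter_upwards [hS f, normalizer_mul_cexp hm hw f, eq_mul_conj_of_cexpSq_mul_le hm hu hw hG,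
      cexp_eq_zero_on hm hzero hwf0, ae_eq_zero_of_cexpSq_eq_top hm hu hG] with x h1 h2 h3 h4 h5
    rw [h1, h2]
    by_cases hκ : normalizer m μ w x = 0
    · rw [hκ, Complex.ofReal_zero, zero_pow two_ne_zero, zero_mul, zero_mul, mul_zero]
      by_cases hW : cexpSq m μ w x = 0
      · rw [h4 hW, mul_zero]
      · rw [h5 (by_contra fun ht => normalizer_ne_zero_iff.2 ⟨hW, ht⟩ hκ), map_zero, zero_mul]
    · rw [congrArg (starRingEnd ℂ) (h3 hκ), map_mul, map_mul, map_pow, Complex.conj_ofReal,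
        Complex.conj_conj]
      ring

end NormalForm

end WCT

open WCT in
theorem proposition3p4 {X : Type*} (m : MeasurableSpace X) {m0 : MeasurableSpace X}
    (hm : m ≤ m0) (μ : Measure X) [SigmaFinite μ] [SigmaFinite (μ.trim hm)]
    (u w : X → ℂ) (hu : AEStronglyMeasurable u μ) (hw : AEStronglyMeasurable w μ)
    (hu_cond : WCT.Conditionable m μ u) (hw_cond : WCT.Conditionable m μ w)
    (T : Lp ℂ 2 μ →L[ℂ] Lp ℂ 2 μ) (hT : WCT.IsWeightedCondOp m μ w u T)
    (hG : ∀ᵐ x ∂μ, WCT.cexpSq m μ w x ≠ 0 →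
      WCT.cexpSq m μ u x * WCT.cexpSq m μ w x
        ≤ ‖WCT.cexp m μ (fun y => u y * w y) x‖ₑ ^ 2) :
    (∀ z₀ : ℂ, z₀ ≠ 0 →
      WCT.IsIsolatedPt (WCT.essRange μ (WCT.cexp m μ (fun y => u y * w y))) z₀ →
      WCT.IsSimplePoleOfResolvent T z₀) ∧
    (∃ S : Lp ℂ 2 μ →L[ℂ] Lp ℂ 2 μ,
      WCT.IsWeightedCondOp m μ (fun x => starRingEnd ℂ (u x)) (fun x => starRingEnd ℂ (w x)) S ∧
      ∀ z₀ : ℂ, z₀ ≠ 0 →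
        WCT.IsIsolatedPt (WCT.essRange μ (WCT.cexp m μ (fun y => u y * w y))) z₀ →
        ∀ r : ℝ, 0 < r → Metric.closedBall z₀ r ∩ spectrum ℂ T = {z₀} →
          (IsSelfAdjoint (WCT.rieszIdempotent T z₀ r) ↔
            LinearMap.ker ((T - z₀ • ContinuousLinearMap.id ℂ (Lp ℂ 2 μ) :
                Lp ℂ 2 μ →L[ℂ] Lp ℂ 2 μ) : Lp ℂ 2 μ →ₗ[ℂ] Lp ℂ 2 μ) ≤
              LinearMap.ker ((S - (starRingEnd ℂ z₀) • ContinuousLinearMap.id ℂ (Lp ℂ 2 μ) :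
                Lp ℂ 2 μ →L[ℂ] Lp ℂ 2 μ) : Lp ℂ 2 μ →ₗ[ℂ] Lp ℂ 2 μ))) := by
  have hT' := isNormalForm_of_isWeightedCondOp hm hu hw hT hG
  refine ⟨fun z₀ h0 hiso => hT'.isSimplePoleOfResolvent hm h0 hiso, ?_⟩
  obtain ⟨S, hS, hker⟩ := hT'.exists_conj hm
  refine ⟨S, isWeightedCondOp_conj hm hu hw hG hS, fun z₀ h0 hiso r hr hspec => ?_⟩
  -- Both sides of the equivalence hold outright under the standing inequality.
  refine iff_of_true (hT'.isSelfAdjoint_rieszIdempotent hm h0 hiso hr hspec) fun f hf => ?_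
  have hf' : T f - z₀ • f = 0 := hf
  change S f - starRingEnd ℂ z₀ • f = 0
  rw [hker z₀ h0 f (sub_eq_zero.1 hf'), sub_self]
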